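/- **Setting.** For every prime $p$ let $K_p$ be a nonarchimedean local field of residue characteristic $p$ (for instance $\mathbb{Q}_p$), with residue field of cardinality $q_p$, normalized absolute value $|\cdot|$ (a uniformizer has absolute value $1/q_p$), Haar measure giving the ring of integers measure $1$, and a continuous additive character $\chi_p$ that is trivial on the ring of integers but not on the next larger fractional ideal. For $\alpha\in\mathbb{N}$ let $\Delta^\alpha=\mathscr{F}^{-1}|\xi|^\alpha\mathscr{F}$ be the Vladimirov–Taibleson operator on $L^2(K_p)$. A *diffusion pair* $(G,\Delta)$ is a finite connected simple graph $G$ with vertex set $V$ together with parameters $\Delta=(\alpha_{ab})$, $\alpha_{ab}=\alpha_{ba}\in\mathbb{N}$ for $a,b\in V$, with $\alpha_{ab}>0$ whenever $ab$ is an edge of $G$. Its *$p$-adic Laplacian* $\Lambda_p=\Lambda_{G,p}^{\Delta}$ is the operator on $L^2(K_p)^{V}$ given by the matrix with entries $-\Delta^{\alpha_{ab}}$ at $(a,b)$ if $ab$ is an edge, $0$ at the other off-diagonal places, and $\sum_{g\sim a}\Delta^{\alpha_{ag}}$ at $(a,a)$. For an element $y$ of a commutative ring let $L(y)$ be the Laplacian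 matrix of $G$ with edge weights $y^{\alpha_{ab}}$. For $r\in\mathbb{Z}$ put $L_r=L_{r,p}=L(q_p^{1-r})$, and let $\mathrm{Spec}(L_r)$ be its multiset of $|V|$ eigenvalues. The *spectral polynomial* is $P_G^\Delta(X,Y)=\det(X-L(Y))\in\mathbb{Z}[X,Y]$; the *spectral curve* is the completion of $P_G^\Delta=0$ in the projective plane over $\overline{\mathbb{Q}}$. The multiset $\mathrm{Spec}(\Lambda_p)$ counts the block of $\Lambda_p$ at each wavelet scale once: the multiplicity of $z\in\mathbb{C}$ is $\sum_{r\in\mathbb{Z}}\dim\{v\in\mathbb{C}^V:\Lambda_p(v\otimes\psi)=z\,(v\otimes\psi)\text{ for all }\psi\in L^2(K_p)\text{ with }\Delta^1\psi=q_p^{1-r}\psi\}\in\mathbb{N}\cup\{\infty\}$. **Theorem.** Let the fields $K_p$, a finite set $V$ and parameters $\Delta=(\alpha_{ab})_{a,b\in V}$, $\alpha_{ab}=\alpha_{ba}\in\mathbb{N}$, be given. Consider the game in which an unknown connected simple graph $G$ on $V$, with $\alpha_{ab}>0$ on its edges, is fixed, and the player, who knows $V$ and $\Delta$ but not $G$,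 repeatedly chooses a prime $p$ (depending on the answers so far) and receives the multiset $\mathrm{Spec}(\Lambda_{G,p}^{\Delta})$. There are a strategy, a finite set $S\subset\mathbb{Z}$ and, for each prime $p$, a rule that assigns to every family of multisets indexed by $S$ a polynomial in $\mathbb{Z}[X,Y]$ and a subset of the projective plane over $\overline{\mathbb Q}$, all independent of $G$, such that for every such $G$ the play stops after finitely many, and at least one, choices of primes, and for every chosen prime $p$: 1. the strategy outputs the distinguished multisets $\mathrm{Spec}(L_{r,p})$ for all $r\in\mathbb{Z}$; 2. these sort the received spectrum: as multisets $\mathrm{Spec}(\Lambda_p)=\biguplus_{r\in\mathbb{Z}}\mathrm{Spec}(L_{r,p})$, and $z\in\mathbb{C}$ is an eigenvalue of $\Lambda_p$ on $L^2(K_p)^V$ if and only if $z\in\mathrm{Spec}(L_{r,p})$ for some $r$; 3. the rule for $p$, applied to $(\mathrm{Spec}(L_{r,p}))_{r\in S}$, yields the spectral polynomial $P_G^\Delta$ and the spectral curve of $(G,\Delta)$. -/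

import Mathlib

open MeasureTheory Filter Topology Polynomial

noncomputable section

namespace DiffusionPair

/-! ### Weighted graph Laplacians, the spectral polynomial and the spectral curve -/

section Graph

variable {V : Type*} [Fintype V]

open Classical in
/-- The Laplacian matrix of the graph `G` in which the edge `e` has weight `y ^ α e`. -/
def lapMatrix {R : Type*} [CommRing R] (G : SimpleGraph V) (α : Sym2 V → ℕ) (y : R) :
    Matrix V V R := fun a b =>
  if a = b then ∑ g, (if G.Adj a g then y ^ α s(a, g) else 0)
  else if G.Adj a b then -y ^ α s(a, b) else 0

open Classical in
/-- The multiset `Spec L_r` of the eigenvalues (with multiplicity) of the Laplacian matrix `L_r` of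
the weighted graph `G_r`, in which the edge `e` has weight `q ^ (α e * (1 - r))`. -/
def specL (q : ℕ) (G : SimpleGraph V) (α : Sym2 V → ℕ) (r : ℤ) : Multiset ℂ :=
  (lapMatrix G α ((q : ℂ) ^ (1 - r))).charpoly.roots

open Classical in
/-- The spectral polynomial `P(X, Y) = det (X - L(Y))` in `ℤ[Y][X]`: the outer variable is `X`, the
inner variable is `Y`, and the edge `e` has weight `Y ^ α e`. -/
def spectralPolynomial (G : SimpleGraph V) (α : Sym2 V → ℕ) : ℤ[X][X] :=
  (lapMatrix G α (Polynomial.X : ℤ[X])).charpoly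

end Graph

/-- The total degree of `P(X, Y)`. -/
def totalDeg (P : ℤ[X][X]) : ℕ := P.support.sup fun i => i + (P.coeff i).natDegree

/-- The value at `(x, y, z)` of the homogenization of `P(X, Y)`, with `z` the extra variable. -/
def homEval {F : Type*} [Field F] (P : ℤ[X][X]) (x y z : F) : F :=
  P.sum fun i a => a.sum fun j c => (c : F) * x ^ i * y ^ j * z ^ (totalDeg P - (i + j))

/-- The completion in the projective plane over the algebraic closure of `ℚ` of the affine plane
curve `P = 0`. -/
def projectiveCurve (P : ℤ[X][X]) :
    Set (Projectivization (AlgebraicClosure ℚ) (Fin 3 → AlgebraicClosure ℚ)) :=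
  {t | homEval P (t.rep 0) (t.rep 1) (t.rep 2) = 0}

/-- The spectral curve of the diffusion pair `(G, α)`. -/
def spectralCurve {V : Type*} [Fintype V] (G : SimpleGraph V) (α : Sym2 V → ℕ) :
    Set (Projectivization (AlgebraicClosure ℚ) (Fin 3 → AlgebraicClosure ℚ)) :=
  projectiveCurve (spectralPolynomial G α)

/-! ### The `p`-adic Laplacian -/

section Operator

variable {K : Type*} [NontriviallyNormedField K] [IsUltrametricDist K]

variable (K) in
/-- The number `q` of elements of the residue field of `K`. -/
def residueCard : ℕ :=
  Nat.card (IsLocalRing.ResidueField (NormedField.valuation (K := K)).integer)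

variable [MeasurableSpace K]

/-- The usual normalizations for harmonic analysis on a locally compact nonarchimedean field `K` of
residue characteristic `p`. -/
structure IsNormalized (p : ℕ) (μ : Measure K) (χ : AddChar K Circle) : Prop where
  /-- the residue characteristic is `p` -/
  norm_p_lt_one : ‖(p : K)‖ < 1
  /-- the absolute value is normalized: a uniformizer has absolute value `1 / q` -/
  exists_uniformizer :
    ∃ ϖ : K, ‖ϖ‖ = (residueCard K : ℝ)⁻¹ ∧ ∀ x : K, ‖x‖ < 1 → ‖x‖ ≤ ‖ϖ‖
  /-- `μ` is a Haar measure -/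
  isAddHaar : μ.IsAddHaarMeasure
  /-- the ring of integers has measure `1` -/
  measure_integers : μ (Metric.closedBall (0 : K) 1) = 1
  /-- `χ` is continuous -/
  continuous_char : Continuous χ
  /-- `χ` is trivial on the ring of integers `O` -/
  char_integers : ∀ x : K, ‖x‖ ≤ 1 → χ x = 1
  /-- `χ` is not trivial on the next larger fractional ideal -/
  char_nontrivial : ∃ x : K, ‖x‖ ≤ residueCard K ∧ χ x ≠ 1

variable (μ : Measure K) (χ : AddChar K Circle)

/-- `g` is the Fourier transform of `f` in `L²(K)`: the limit in `L²(K)` of the Fourier integrals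
of the truncations of `f` to balls. -/
def IsFourier (f g : Lp ℂ 2 μ) : Prop :=
  Tendsto (fun N : ℕ => eLpNorm (fun ξ : K =>
    (∫ x in Metric.closedBall (0 : K) N, (χ (ξ * x) : ℂ) * f x ∂μ) - g ξ) 2 μ) atTop (𝓝 0)

/-- `f` is in the domain of the Vladimirov-Taibleson operator `Δ^α` on `L²(K)`, and `Δ^α f = h`.
That is, `h = 𝓕⁻¹ (|ξ|^α 𝓕 f)`. -/
def IsVladimirov (α : ℕ) (f h : Lp ℂ 2 μ) : Prop :=
  ∃ u w : Lp ℂ 2 μ, IsFourier μ χ f u ∧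
    (∀ᵐ ξ ∂μ, w ξ = ((‖ξ‖ ^ α : ℝ) : ℂ) * u ξ) ∧ IsFourier μ χ h w

variable {V : Type*} [Fintype V]

open Classical in
/-- `f` is in the domain of the `p`-adic Laplacian `Λ` of the diffusion pair `(G, α)`, an operator
on `L²(K)^V`, and `Λ f = h`. The matrix of `Λ` has the entry `-Δ^(α e)` at `(a, b)` if `e = ab` is
an edge, and at `(a, a)` the sum of `Δ^(α e)` over the edges `e` at `a`. Below, `A a b` is
`Δ^(α e) (f a)` and `B a b` is `Δ^(α e) (f b)`, where `e = ab`. -/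
def IsLaplacian (G : SimpleGraph V) (α : Sym2 V → ℕ) (f h : V → Lp ℂ 2 μ) : Prop :=
  ∃ A B : V → V → Lp ℂ 2 μ,
    (∀ a b, G.Adj a b →
      IsVladimirov μ χ (α s(a, b)) (f a) (A a b) ∧ IsVladimirov μ χ (α s(a, b)) (f b) (B a b)) ∧
    ∀ a, h a = ∑ b, if G.Adj a b then A a b - B a b else 0

/-- `z` is an eigenvalue of the `p`-adic Laplacian on `L²(K)^V`. -/
def IsEigenvalue (G : SimpleGraph V) (α : Sym2 V → ℕ) (z : ℂ) : Prop :=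
  ∃ f : V → Lp ℂ 2 μ, f ≠ 0 ∧ IsLaplacian μ χ G α f (z • f)

/-- `ψ` lies in the closed span of the Kozyrev wavelets `ψ_{r,n}` (`n ∈ ℕ`) of scale `r`, which is
the eigenspace of the Vladimirov operator `Δ¹` for the eigenvalue `q ^ (1 - r)`. -/
def IsScale (r : ℤ) (ψ : Lp ℂ 2 μ) : Prop :=
  IsVladimirov μ χ 1 ψ (((residueCard K : ℂ) ^ (1 - r)) • ψ)

/-- The `z`-eigenspace of the block of the `p`-adic Laplacian at scale `r`: the `v ∈ ℂ^V` such that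
`Λ (v ⊗ ψ) = z (v ⊗ ψ)` for every `ψ` of scale `r`. (These `v` form a subspace.) -/
def blockEigenspace (G : SimpleGraph V) (α : Sym2 V → ℕ) (r : ℤ) (z : ℂ) :
    Submodule ℂ (V → ℂ) :=
  Submodule.span ℂ {v | ∀ ψ : Lp ℂ 2 μ, IsScale μ χ r ψ →
    IsLaplacian μ χ G α (fun a => v a • ψ) (fun a => z • v a • ψ)}

/-- The multiset `Spec Λ`, as the function that sends `z` to its multiplicity. In `L²(K)^V` the
block of `Λ` at scale `r` is repeated once for each of the infinitely many wavelets of this scale;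
in the multiset it is counted once for each scale. -/
def specLambda (G : SimpleGraph V) (α : Sym2 V → ℕ) (z : ℂ) : ℕ∞ :=
  ∑' r : ℤ, (Module.finrank ℂ (blockEigenspace μ χ G α r z) : ℕ∞)

end Operator

/-! ### The game -/

/-- What the player has seen so far: the primes that were chosen, each with the multiset
`Spec Λ` (as a multiplicity function) that was received for it. -/
abbrev History : Type := List (Nat.Primes × (ℂ → ℕ∞))

/-- A strategy: depending on what has been seen so far, choose a further prime number, or stop with
an output in `O`. -/
abbrev Strategy (O : Type*) := History → Nat.Primes ⊕ O

/-- `EndsFrom σ ans h h' o`: if the strategy `σ` is played from the history `h` on, and `ans p` is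
the answer to the prime `p`, then the play stops after finitely many rounds, with final history `h'`
and output `o`. -/
inductive EndsFrom {O : Type*} (σ : Strategy O) (ans : Nat.Primes → ℂ → ℕ∞) :
    History → History → O → Prop
  | finish (h : History) (o : O) : σ h = Sum.inr o → EndsFrom σ ans h h o
  | ask (h : History) (p : Nat.Primes) (h' : History) (o : O) : σ h = Sum.inl p →
      EndsFrom σ ans (h ++ [(p, ans p)]) h' o → EndsFrom σ ans h h' o

end DiffusionPair

end

noncomputable section

namespace DiffusionPair

/-! ### Laplacian matrices as specializations of one polynomial matrix. -/

section Algebra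

variable {V : Type*} [Fintype V]

/-! The Fourier transform turns Λ into multiplication by the matrix L(‖ξ‖). Nonzero norms are powers
q^(1-r), so Λ splits into blocks, and the block at scale r is L_r. Hence Spec Λ is the union of the
Spec L_r (`IsNormalized.specLambda_eq`), and injectivity of the Fourier transform shows that there
are no further eigenvalues (`IsNormalized.isEigenvalue_iff`).

There are only finitely many graphs on V, so it suffices to separate two graphs with different
spectral polynomials P, P' by one large prime (`exists_forall_unionCount_ne`). The logarithmic
derivatives of P and P' in X differ, so for some t > 0 their difference at X = -t is a nonzero
rational function D(Y). At Y = y each logarithmic derivative is minus the sum of 1/(l + t) over the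
eigenvalues l of L(y). By connectedness 0 is a simple eigenvalue, and its term 1/t cancels in D; the
other eigenvalues grow at least linearly in y, by a Poincaré inequality and positivity of the
exponents. So D vanishes at infinity, and for large q the sum of D(q^(k+1)) over k ≥ 0 is dominated
by its first term, hence nonzero. This sum is visible in the unsorted union: for r ≥ 1 the
eigenvalues are at most 2|V|, while for r ≤ 0 and large q the nonzero ones exceed 2|V|, so a cutoff
isolates the latter. Since q_p ≥ p, large q are available.

The strategy therefore asks a fixed finite list of primes and outputs the spectra of any admissible
graph consistent with the answers: it has the right spectral polynomial, which determines every Spec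
L_r. Conversely, enough of the Spec L_r give back P by interpolation in Y
(`spectralPolynomial_eq_of_specL`). -/

lemma lapMatrix_map {R S : Type*} [CommRing R] [CommRing S] (φ : R →+* S)
    (G : SimpleGraph V) (α : Sym2 V → ℕ) (y : R) :
    (lapMatrix G α y).map φ = lapMatrix G α (φ y) := by
  ext a b
  simp only [Matrix.map_apply, lapMatrix]
  split_ifs <;> simp [apply_ite φ]

lemma lapMatrix_symm {R : Type*} [CommRing R] (G : SimpleGraph V) (α : Sym2 V → ℕ) (y : R)
    (a b : V) : lapMatrix G α y a b = lapMatrix G α y b a := by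
  by_cases h : a = b
  · rw [h]
  · by_cases h2 : G.Adj a b
    · simp [lapMatrix, h, Ne.symm h, h2, h2.symm, Sym2.eq_swap (a := a)]
    · simp [lapMatrix, h, Ne.symm h, h2, mt (G.adj_symm (u := b)) h2]

open Classical in
-- The difference form serves both the energy identity and the comparison with `IsLaplacian`, which
-- is written in differences.
lemma lapMatrix_mulVec {R : Type*} [CommRing R] (G : SimpleGraph V) (α : Sym2 V → ℕ) (y : R)
    (v : V → R) (a : V) :
    (lapMatrix G α y).mulVec v a
      = ∑ b, if G.Adj a b then y ^ α s(a, b) * (v a - v b) else 0 := by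
  have h : ∀ b, lapMatrix G α y a b * v b
      = (if a = b then (∑ g, (if G.Adj a g then y ^ α s(a, g) else 0)) * v a else 0)
        - (if G.Adj a b then y ^ α s(a, b) * v b else 0) := by
    intro b
    by_cases hab : a = b
    · subst hab
      simp [lapMatrix]
    · by_cases h2 : G.Adj a b <;> simp [lapMatrix, hab, h2]
  simp only [Matrix.mulVec, dotProduct, h, Finset.sum_sub_distrib, Finset.sum_ite_eq,
    Finset.mem_univ, if_true, Finset.sum_mul]
  rw [← Finset.sum_sub_distrib]
  refine Finset.sum_congr rfl fun b _ => ?_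
  split_ifs <;> ring

lemma lapMatrix_isHermitian {𝕜 : Type*} [RCLike 𝕜] (G : SimpleGraph V) (α : Sym2 V → ℕ) (y : ℝ) :
    (lapMatrix G α (y : 𝕜)).IsHermitian := by
  have h : lapMatrix G α (y : 𝕜) = (lapMatrix G α y).map (algebraMap ℝ 𝕜) :=
    (lapMatrix_map (algebraMap ℝ 𝕜) G α y).symm
  ext a b
  simp only [h, Matrix.conjTranspose_apply, Matrix.map_apply, lapMatrix_symm G α y b a]
  exact RCLike.conj_ofReal _

open Classical in
lemma charpoly_lapMatrix {R : Type*} [CommRing R] (G : SimpleGraph V) (α : Sym2 V → ℕ) (y : R) :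
    (lapMatrix G α y).charpoly
      = (spectralPolynomial G α).map (Polynomial.eval₂RingHom (Int.castRingHom R) y) := by
  rw [spectralPolynomial, ← Matrix.charpoly_map, ← RingHom.mapMatrix_apply,
    RingHom.mapMatrix_apply, lapMatrix_map]
  simp

open Classical in
lemma spectralPolynomial_monic (G : SimpleGraph V) (α : Sym2 V → ℕ) :
    (spectralPolynomial G α).Monic := Matrix.charpoly_monic _

open Classical in
lemma spectralPolynomial_natDegree (G : SimpleGraph V) (α : Sym2 V → ℕ) :
    (spectralPolynomial G α).natDegree = Fintype.card V := Matrix.charpoly_natDegree_eq_dim _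

lemma specL_congr {G G' : SimpleGraph V} {α : Sym2 V → ℕ}
    (h : spectralPolynomial G α = spectralPolynomial G' α) (q : ℕ) (r : ℤ) :
    specL q G α r = specL q G' α r := by
  simp only [specL, charpoly_lapMatrix, h]

end Algebra

/-! ### Multiplicities of eigenvalues of Hermitian matrices. -/

section Hermitian

variable {n : Type*} [Fintype n] [DecidableEq n]

/-- For a Hermitian matrix, algebraic and geometric multiplicities agree. -/
lemma count_roots_charpoly_eq_finrank {𝕜 : Type*} [RCLike 𝕜] {A : Matrix n n 𝕜}
    (hA : A.IsHermitian) (z : 𝕜) :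
    A.charpoly.roots.count z = Module.finrank 𝕜 (LinearMap.ker (A - z • 1).mulVecLin) := by
  classical
  -- Unitary diagonalization preserves rank, so rank-nullity reduces the claim to counting zero
  -- diagonal entries.
  have h1 : (A - z • 1).rank
      = (Matrix.diagonal (fun i => (hA.eigenvalues i : 𝕜) - z)).rank := by
    have h2 : A - z • 1 = (hA.eigenvectorUnitary : Matrix n n 𝕜)
        * Matrix.diagonal (fun i => (hA.eigenvalues i : 𝕜) - z)
        * star (hA.eigenvectorUnitary : Matrix n n 𝕜) := by
      have h3 : Matrix.diagonal (fun i => (hA.eigenvalues i : 𝕜) - z)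
          = Matrix.diagonal (RCLike.ofReal ∘ hA.eigenvalues) - z • (1 : Matrix n n 𝕜) := by
        ext i j
        by_cases h : i = j
        · subst h; simp
        · simp [h]
      rw [h3, mul_sub, sub_mul]
      conv_lhs => rw [hA.spectral_theorem, Unitary.conjStarAlgAut_apply]
      simp
    rw [h2, ← Unitary.coe_star]
    rw [Matrix.rank_mul_eq_left_of_isUnit_det, Matrix.rank_mul_eq_right_of_isUnit_det]
    · exact (Matrix.isUnit_iff_isUnit_det _).1 (Unitary.toUnits hA.eigenvectorUnitary).isUnit
    · exact (Matrix.isUnit_iff_isUnit_det _).1 (Unitary.toUnits (star hA.eigenvectorUnitary)).isUnit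
  have h4 := LinearMap.finrank_range_add_finrank_ker (A - z • 1).mulVecLin
  have h5 : Module.finrank 𝕜 (LinearMap.range (A - z • 1).mulVecLin)
      = Fintype.card {i // (hA.eigenvalues i : 𝕜) - z ≠ 0} := by
    rw [← Matrix.rank_diagonal, ← h1, Matrix.rank]
  rw [h5, Module.finrank_pi] at h4
  have h6 : A.charpoly.roots.count z = Fintype.card {i // (hA.eigenvalues i : 𝕜) - z = 0} := by
    rw [hA.roots_charpoly_eq_eigenvalues, Multiset.count_map, Fintype.card_subtype,
      Finset.card_def, Finset.filter_val]
    congr 1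
    refine Multiset.filter_congr fun i _ => ?_
    rw [sub_eq_zero, eq_comm]
    rfl
  have h7 := Fintype.card_subtype_compl (fun i => (hA.eigenvalues i : 𝕜) - z = 0)
  have h8 := Fintype.card_subtype_le (fun i => (hA.eigenvalues i : 𝕜) - z = 0)
  simp only [ne_eq] at h4
  omega

end Hermitian

/-! ### Logarithmic derivatives and evaluation at negative integers. -/

section PolynomialFacts

/-- Monic polynomials of the same degree with the same logarithmic derivative are equal. -/
lemma eq_of_derivative_mul_eq {R : Type*} [CommRing R] [IsDomain R] [CharZero R] {P Q : R[X]}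
    (hP : P.Monic) (hQ : Q.Monic) (hdeg : P.natDegree = Q.natDegree)
    (h : derivative P * Q = P * derivative Q) : P = Q := by
  by_contra hne
  have hR : P - Q ≠ 0 := sub_ne_zero.2 hne
  have hlt : (P - Q).natDegree < Q.natDegree := by
    refine natDegree_lt_natDegree hR (degree_sub_lt_right ?_ hQ.ne_zero ?_)
    · rw [degree_eq_natDegree hP.ne_zero, degree_eq_natDegree hQ.ne_zero, hdeg]
    · rw [hP.leadingCoeff, hQ.leadingCoeff]
  have h2 : derivative (P - Q) * Q = (P - Q) * derivative Q := by
    rw [derivative_sub, sub_mul, sub_mul, h, mul_comm Q]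
  have hlc : (P - Q).coeff (P - Q).natDegree ≠ 0 := leadingCoeff_ne_zero.2 hR
  obtain ⟨l, hl⟩ : ∃ l, Q.natDegree = l + 1 := ⟨Q.natDegree - 1, by omega⟩
  have hQl : Q.coeff (l + 1) = 1 := by rw [← hl]; exact hQ
  have hQd : (derivative Q).natDegree ≤ l := (natDegree_derivative_le Q).trans (by omega)
  -- With R = P - Q, compare coefficients of degree deg R + deg Q - 1 in R'Q = RQ': they give deg R
  -- = deg Q, against deg R < deg Q. If R is constant, the left side is zero and the right side is
  -- not.
  have h3 : ((P - Q) * derivative Q).coeff ((P - Q).natDegree + l)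
      = (P - Q).coeff (P - Q).natDegree * ((l : R) + 1) := by
    rw [coeff_mul_add_eq_of_natDegree_le le_rfl hQd, coeff_derivative, hQl, one_mul]
  rcases Nat.eq_zero_or_pos (P - Q).natDegree with h0 | h0
  · have h4 : derivative (P - Q) = 0 := by
      rw [eq_C_of_natDegree_eq_zero h0, derivative_C]
    rw [← h2, h4, zero_mul, coeff_zero, eq_comm, mul_eq_zero] at h3
    exact h3.elim hlc (by exact_mod_cast Nat.succ_ne_zero l)
  · obtain ⟨k, hk⟩ : ∃ k, (P - Q).natDegree = k + 1 := ⟨(P - Q).natDegree - 1, by omega⟩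
    have hkd : (derivative (P - Q)).natDegree ≤ k := (natDegree_derivative_le _).trans (by omega)
    rw [← h2, hk, show k + 1 + l = k + (l + 1) by ring,
      coeff_mul_add_eq_of_natDegree_le hkd hl.le, coeff_derivative, hQl, mul_one] at h3
    rw [hk] at hlc
    have h5 : k = l := by
      have := mul_left_cancel₀ hlc h3
      have h6 : k + 1 = l + 1 := by exact_mod_cast this
      omega
    omega

lemma exists_nat_eval_ne_zero {R : Type*} [CommRing R] [IsDomain R] [CharZero R] {P : R[X]}
    (hP : P ≠ 0) : ∃ t : ℕ, 0 < t ∧ P.eval (-(t : R)) ≠ 0 := by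
  by_contra! hc
  refine hP (Polynomial.eq_zero_of_infinite_isRoot P ?_)
  refine Set.Infinite.mono (s := Set.range fun t : ℕ => (-((t + 1 : ℕ) : R))) ?_
    (Set.infinite_range_of_injective ?_)
  · rintro _ ⟨t, rfl⟩
    exact hc (t + 1) (Nat.succ_pos t)
  · intro a b hab
    simpa using hab

end PolynomialFacts

/-! ### Recovering the spectral polynomial from finitely many scales. -/

section Interpolation

variable {V : Type*} [Fintype V]

/-- A bound for the `Y`-degrees of the spectral polynomials of all graphs on `V`. -/
def degreeBound (α : Sym2 V → ℕ) : ℕ :=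
  (Set.toFinite (Set.univ : Set (SimpleGraph V))).toFinset.sup fun G =>
    (spectralPolynomial G α).support.sup fun i => ((spectralPolynomial G α).coeff i).natDegree

lemma natDegree_coeff_le_degreeBound (G : SimpleGraph V) (α : Sym2 V → ℕ) (i : ℕ) :
    ((spectralPolynomial G α).coeff i).natDegree ≤ degreeBound α := by
  by_cases h : i ∈ (spectralPolynomial G α).support
  · refine (Finset.le_sup (f := fun i => ((spectralPolynomial G α).coeff i).natDegree) h).trans ?_
    exact Finset.le_sup (f := fun G => (spectralPolynomial G α).support.sup fun i =>
      ((spectralPolynomial G α).coeff i).natDegree) (by simp)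
  · simp [notMem_support_iff.1 h]

/-- The spectra of sufficiently many of the matrices `L_r` determine the spectral polynomial. -/
lemma spectralPolynomial_eq_of_specL {G G' : SimpleGraph V} {α : Sym2 V → ℕ} {q : ℕ} (hq : 2 ≤ q)
    {S : Finset ℤ} (hS : degreeBound α < S.card)
    (h : ∀ r ∈ S, specL q G α r = specL q G' α r) :
    spectralPolynomial G α = spectralPolynomial G' α := by
  classical
  -- Over ℂ a monic polynomial is the product of its linear factors, so equal root multisets give
  -- equal characteristic polynomials.
  have hchar : ∀ r ∈ S, (lapMatrix G α ((q : ℂ) ^ (1 - r))).charpoly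
      = (lapMatrix G' α ((q : ℂ) ^ (1 - r))).charpoly := by
    intro r hr
    have h1 := h r hr
    simp only [specL] at h1
    rw [(IsAlgClosed.splits (lapMatrix G α ((q : ℂ) ^ (1 - r))).charpoly).eq_prod_roots_of_monic
        (Matrix.charpoly_monic _),
      (IsAlgClosed.splits (lapMatrix G' α ((q : ℂ) ^ (1 - r))).charpoly).eq_prod_roots_of_monic
        (Matrix.charpoly_monic _)]
    convert congrArg (fun m : Multiset ℂ => (m.map fun a => X - C a).prod) h1
  ext1 i
  have hinj : Function.Injective (Int.castRingHom ℂ) := Int.cast_injective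
  apply Polynomial.map_injective _ hinj
  have hq1 : (1 : ℝ) < q := by exact_mod_cast hq
  have hpow : Function.Injective fun r : ℤ => (q : ℂ) ^ (1 - r) := by
    intro r s hrs
    simp only at hrs
    have h2 : (q : ℝ) ^ (1 - r) = (q : ℝ) ^ (1 - s) :=
      Complex.ofReal_injective (by push_cast; exact hrs)
    have := zpow_right_injective₀ (by linarith) hq1.ne' h2
    simpa using this
  -- Each coefficient in X is a polynomial in Y of degree at most `degreeBound α`; the nodes q^(1-r)
  -- are distinct and more numerous than that.
  refine Polynomial.eq_of_degree_sub_lt_of_eval_finset_eq (S.image fun r : ℤ => (q : ℂ) ^ (1 - r))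
    ?_ ?_
  · rw [Finset.card_image_of_injective _ hpow]
    refine lt_of_le_of_lt degree_le_natDegree ?_
    rw [Nat.cast_lt]
    refine lt_of_le_of_lt
      (natDegree_sub_le_of_le (m := degreeBound α) (n := degreeBound α) ?_ ?_) ?_
    · exact natDegree_map_le.trans (natDegree_coeff_le_degreeBound G α i)
    · exact natDegree_map_le.trans (natDegree_coeff_le_degreeBound G' α i)
    · simpa using hS
  · intro y hy
    obtain ⟨r, hr, rfl⟩ := Finset.mem_image.1 hy
    have h1 := congrArg (fun P => P.coeff i) (hchar r hr)
    simp only [charpoly_lapMatrix, coeff_map, coe_eval₂RingHom] at h1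
    simpa only [eval_map] using h1

end Interpolation

/-! ### Sums of a rational function along powers of a large number. -/

section RationalDecay

/-- A polynomial is asymptotic to its leading term, so their ratio eventually lies in (1/2, 2). -/
lemma eventually_abs_eval_bounds {p : ℝ[X]} :
    ∀ᶠ y : ℝ in atTop, |p.leadingCoeff| / 2 * y ^ p.natDegree ≤ |p.eval y| ∧
      |p.eval y| ≤ 2 * |p.leadingCoeff| * y ^ p.natDegree := by
  obtain ⟨φ, hφ, h⟩ := (Polynomial.isEquivalent_atTop_lead (P := p)).exists_eq_mul
  filter_upwards [h, hφ.eventually (Ioo_mem_nhds (a := (1 / 2 : ℝ)) (b := 2) (by norm_num)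
    (by norm_num)), eventually_ge_atTop (0 : ℝ)] with y hy hφy hy0
  rw [hy, Pi.mul_apply, abs_mul, abs_mul, abs_of_nonneg (pow_nonneg hy0 _),
    abs_of_pos (show 0 < φ y by linarith [hφy.1])]
  have h0 : 0 ≤ |p.leadingCoeff| * y ^ p.natDegree := by positivity
  constructor <;> nlinarith [hφy.1, hφy.2]

/-- A nonzero rational function that vanishes at infinity decays geometrically along the powers of
a large number. -/
lemma eventually_abs_div_pow_le {N M : ℝ[X]} (hN : N ≠ 0) (hM : M ≠ 0)
    (hdeg : N.degree < M.degree) :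
    ∀ᶠ q : ℝ in atTop, N.eval q / M.eval q ≠ 0 ∧ ∀ k : ℕ,
      |N.eval (q ^ (k + 1)) / M.eval (q ^ (k + 1))| ≤ 16 * |N.eval q / M.eval q| * (q⁻¹) ^ k := by
  obtain ⟨Y, hY⟩ := eventually_atTop.1 ((eventually_abs_eval_bounds (p := N)).and
    (eventually_abs_eval_bounds (p := M)))
  filter_upwards [eventually_ge_atTop Y, eventually_ge_atTop (1 : ℝ)] with q hq hq1
  have hn : 0 < |N.leadingCoeff| := abs_pos.2 (leadingCoeff_ne_zero.2 hN)
  have hm : 0 < |M.leadingCoeff| := abs_pos.2 (leadingCoeff_ne_zero.2 hM)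
  have hd : N.natDegree + 1 ≤ M.natDegree := natDegree_lt_natDegree hN hdeg
  have hq0 : 0 < q := by linarith
  obtain ⟨e, he⟩ := Nat.exists_eq_add_of_le hd
  set a := |N.leadingCoeff|
  set b := |M.leadingCoeff|
  set d := N.natDegree
  rw [he] at hY
  -- The factor 4 combines the 1/2 from the numerator with the 2 from the denominator. The upper
  -- bound below loses 4 in the other direction, whence 16 in total.
  have hlow : a / (4 * b) * (q ^ (1 + e))⁻¹ ≤ |N.eval q / M.eval q| := by
    obtain ⟨⟨h1, -⟩, h2, h3⟩ := hY q hq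
    have hMpos : 0 < |M.eval q| := lt_of_lt_of_le (by positivity) h2
    rw [abs_div, le_div_iff₀ hMpos]
    refine le_trans (mul_le_mul_of_nonneg_left h3 (by positivity)) (le_trans (le_of_eq ?_) h1)
    field_simp
    ring
  refine ⟨?_, fun k => ?_⟩
  · rw [← abs_pos]
    exact lt_of_lt_of_le (by positivity) hlow
  · have hqk : q ≤ q ^ (k + 1) := le_self_pow₀ hq1 (Nat.succ_ne_zero k)
    set y := q ^ (k + 1) with hy
    have hy0 : 0 < y := by positivity
    obtain ⟨⟨-, h1⟩, h2, -⟩ := hY y (hq.trans hqk)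
    have hMpos : 0 < |M.eval y| := lt_of_lt_of_le (by positivity) h2
    have hup : |N.eval y / M.eval y| ≤ 4 * a / b * (y ^ (1 + e))⁻¹ := by
      rw [abs_div, div_le_iff₀ hMpos]
      refine h1.trans (le_trans (le_of_eq ?_) (mul_le_mul_of_nonneg_left h2 (by positivity)))
      field_simp
      ring
    refine hup.trans ?_
    -- Here (k + 1)(1 + e) ≥ 1 + e + k; the degree gap of at least one supplies the geometric
    -- factor.
    have hpow : (y ^ (1 + e))⁻¹ ≤ (q ^ (1 + e))⁻¹ * (q⁻¹) ^ k := by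
      rw [inv_pow, ← mul_inv]
      refine inv_anti₀ (by positivity) ?_
      rw [hy, ← pow_mul, ← pow_add]
      exact pow_le_pow_right₀ hq1 (by nlinarith)
    calc 4 * a / b * (y ^ (1 + e))⁻¹ ≤ 4 * a / b * ((q ^ (1 + e))⁻¹ * (q⁻¹) ^ k) :=
          mul_le_mul_of_nonneg_left hpow (by positivity)
      _ = 16 * (a / (4 * b) * (q ^ (1 + e))⁻¹) * (q⁻¹) ^ k := by field_simp; ring
      _ ≤ _ := by gcongr

/-- The values of a nonzero rational function that vanishes at infinity do not sum to zero along
the powers of a large number. -/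
lemma eventually_tsum_div_ne_zero {N M : ℝ[X]} (hN : N ≠ 0) (hM : M ≠ 0)
    (hdeg : N.degree < M.degree) :
    ∀ᶠ q : ℝ in atTop, ¬ HasSum (fun k : ℕ => N.eval (q ^ (k + 1)) / M.eval (q ^ (k + 1))) 0 := by
  filter_upwards [eventually_abs_div_pow_le hN hM hdeg, eventually_gt_atTop (17 : ℝ)]
    with q ⟨h0, hq⟩ hq17 hsum
  set D : ℕ → ℝ := fun k => N.eval (q ^ (k + 1)) / M.eval (q ^ (k + 1)) with hD
  have hD0 : D 0 = N.eval q / M.eval q := by simp [hD]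
  have h1 : HasSum (fun k => D (k + 1)) (-D 0) := by
    simpa using (hasSum_nat_add_iff' (f := D) 1).2 hsum
  have hlt : q⁻¹ < 1 := inv_lt_one_of_one_lt₀ (by linarith)
  have h2 : HasSum (fun k => 16 * |D 0| * q⁻¹ * q⁻¹ ^ k) (16 * |D 0| * q⁻¹ * (1 - q⁻¹)⁻¹) :=
    (hasSum_geometric_of_lt_one (by positivity) hlt).mul_left _
  have h3 : ‖-D 0‖ ≤ 16 * |D 0| * q⁻¹ * (1 - q⁻¹)⁻¹ := by
    rw [← h1.tsum_eq]
    refine tsum_of_norm_bounded h2 fun k => ?_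
    rw [Real.norm_eq_abs, hD0]
    exact (hq (k + 1)).trans (le_of_eq (by rw [pow_succ]; ring))
  rw [norm_neg, Real.norm_eq_abs] at h3
  have h4 : 0 < |D 0| := by rw [hD0]; exact abs_pos.2 h0
  -- The tail is at most 16/(q - 1) times the first term, hence smaller than it once q > 17, and
  -- cannot cancel it.
  have h5 : 16 * |D 0| * q⁻¹ * (1 - q⁻¹)⁻¹ = |D 0| * (16 / (q - 1)) := by
    have : q - 1 ≠ 0 := by linarith
    have : 1 - q⁻¹ ≠ 0 := by linarith
    field_simp
  have h6 : 16 / (q - 1) < 1 := by rw [div_lt_one] <;> linarith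
  nlinarith

end RationalDecay

/-! ### Bounds for the eigenvalues of the real Laplacian matrix. -/

section Eigenvalues

variable {V : Type*} [Fintype V] (G : SimpleGraph V) (α : Sym2 V → ℕ)

open Classical in
/-- The eigenvalues of the real Laplacian matrix `L(y)`. -/
def realSpec (y : ℝ) : Multiset ℝ := (lapMatrix G α y).charpoly.roots

variable {G α}

open Classical in
lemma splits_charpoly_lapMatrix (y : ℝ) : (lapMatrix G α y).charpoly.Splits :=
  (lapMatrix_isHermitian (𝕜 := ℝ) G α y).splits_charpoly

open Classical in
-- The real symmetric matrix has a characteristic polynomial that already splits over ℝ, so no root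
-- is gained over ℂ.
lemma specL_eq_map_realSpec (q : ℕ) (r : ℤ) :
    specL q G α r = (realSpec G α ((q : ℝ) ^ (1 - r))).map ((↑) : ℝ → ℂ) := by
  have h := (splits_charpoly_lapMatrix (G := G) (α := α) ((q : ℝ) ^ (1 - r))).roots_map
    Complex.ofRealHom
  rw [← Matrix.charpoly_map, lapMatrix_map] at h
  simpa [specL, realSpec] using h

open Classical in
lemma exists_mulVec_eq_of_mem_realSpec {y l : ℝ} (h : l ∈ realSpec G α y) :
    ∃ v : V → ℝ, v ≠ 0 ∧ (lapMatrix G α y).mulVec v = l • v := by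
  have h1 : (lapMatrix G α y).charpoly.IsRoot l := isRoot_of_mem_roots h
  rw [Polynomial.IsRoot, Matrix.eval_charpoly] at h1
  obtain ⟨v, hv, hv2⟩ := Matrix.exists_mulVec_eq_zero_iff.2 h1
  refine ⟨v, hv, ?_⟩
  rw [Matrix.sub_mulVec, sub_eq_zero] at hv2
  rw [← hv2]
  ext a
  simp [Matrix.scalar_apply, Matrix.mulVec_diagonal]

open Classical in
-- Symmetrize the double sum by exchanging a and b. It runs over ordered pairs, so each edge counts
-- twice; hence the division by 2.
lemma sum_mul_lapMatrix_mulVec (y : ℝ) (v : V → ℝ) :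
    ∑ a, v a * (lapMatrix G α y).mulVec v a
      = (∑ a, ∑ b, if G.Adj a b then y ^ α s(a, b) * (v a - v b) ^ 2 else 0) / 2 := by
  simp only [lapMatrix_mulVec, Finset.mul_sum]
  have h : ∑ a, ∑ b, v a * (if G.Adj a b then y ^ α s(a, b) * (v a - v b) else 0)
      = ∑ a, ∑ b, v b * (if G.Adj a b then y ^ α s(a, b) * (v b - v a) else 0) := by
    rw [Finset.sum_comm]
    refine Finset.sum_congr rfl fun a _ => Finset.sum_congr rfl fun b _ => ?_
    rw [Sym2.eq_swap (a := b)]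
    simp only [G.adj_comm b a]
  rw [eq_div_iff two_ne_zero, mul_two]
  conv_lhs => rw [h, ← h]
  nth_rewrite 2 [h]
  rw [← Finset.sum_add_distrib]
  refine Finset.sum_congr rfl fun a _ => ?_
  rw [← Finset.sum_add_distrib]
  refine Finset.sum_congr rfl fun b _ => ?_
  split_ifs <;> ring

open Classical in
-- The summands are antisymmetric in a and b. Consequently an eigenvector with nonzero eigenvalue
-- has sum zero, as the Poincaré inequality requires.
lemma sum_lapMatrix_mulVec (y : ℝ) (v : V → ℝ) :
    ∑ a, (lapMatrix G α y).mulVec v a = 0 := by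
  have h : ∑ a, (lapMatrix G α y).mulVec v a = -∑ a, (lapMatrix G α y).mulVec v a := by
    simp only [lapMatrix_mulVec]
    conv_lhs => rw [Finset.sum_comm]
    rw [← Finset.sum_neg_distrib]
    refine Finset.sum_congr rfl fun a _ => ?_
    rw [← Finset.sum_neg_distrib]
    refine Finset.sum_congr rfl fun b _ => ?_
    rw [Sym2.eq_swap (a := b)]
    simp only [G.adj_comm b a]
    split_ifs <;> ring
  linarith

lemma sum_sq_pos {v : V → ℝ} (hv : v ≠ 0) : 0 < ∑ a, v a ^ 2 := by
  obtain ⟨a, ha⟩ := Function.ne_iff.1 hv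
  exact Finset.sum_pos' (fun a _ => sq_nonneg _) ⟨a, Finset.mem_univ a, sq_pos_of_ne_zero ha⟩

lemma sum_mul_smul (l : ℝ) (v : V → ℝ) : ∑ a, v a * (l • v) a = l * ∑ a, v a ^ 2 := by
  rw [Finset.mul_sum]
  refine Finset.sum_congr rfl fun a _ => ?_
  rw [Pi.smul_apply, smul_eq_mul]
  ring

lemma nonneg_of_mem_realSpec {y l : ℝ} (hy : 0 ≤ y) (h : l ∈ realSpec G α y) : 0 ≤ l := by
  classical
  obtain ⟨v, hv, hv2⟩ := exists_mulVec_eq_of_mem_realSpec h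
  have h1 := sum_mul_lapMatrix_mulVec (G := G) (α := α) y v
  rw [hv2, sum_mul_smul] at h1
  have h2 : 0 ≤ ∑ a, ∑ b, if G.Adj a b then y ^ α s(a, b) * (v a - v b) ^ 2 else 0 :=
    Finset.sum_nonneg fun a _ => Finset.sum_nonneg fun b _ => by split_ifs <;> positivity
  by_contra hl
  nlinarith [sum_sq_pos hv]

lemma le_of_mem_realSpec_of_le_one {y l : ℝ} (hy : 0 ≤ y) (hy1 : y ≤ 1)
    (h : l ∈ realSpec G α y) : l ≤ 2 * Fintype.card V := by
  classical
  obtain ⟨v, hv, hv2⟩ := exists_mulVec_eq_of_mem_realSpec h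
  obtain ⟨a0, ha0⟩ := Function.ne_iff.1 hv
  -- A Gershgorin argument: read the eigenvalue equation at a vertex where |v| is maximal.
  obtain ⟨a, -, ha⟩ := Finset.exists_max_image Finset.univ (fun a => |v a|) ⟨a0, Finset.mem_univ a0⟩
  have hpos : 0 < |v a| := lt_of_lt_of_le (abs_pos.2 ha0) (ha a0 (Finset.mem_univ _))
  have h1 := congrFun hv2 a
  rw [lapMatrix_mulVec, Pi.smul_apply, smul_eq_mul] at h1
  have h2 : |l * v a| ≤ ∑ _b : V, 2 * |v a| := by
    rw [← h1]
    refine (Finset.abs_sum_le_sum_abs _ _).trans (Finset.sum_le_sum fun b _ => ?_)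
    split_ifs
    · rw [abs_mul, abs_of_nonneg (pow_nonneg hy _)]
      have h3 := pow_le_one₀ hy hy1 (n := α s(a, b))
      have h4 : |v a - v b| ≤ 2 * |v a| :=
        (abs_sub _ _).trans (by linarith [ha b (Finset.mem_univ b)])
      nlinarith [abs_nonneg (v a - v b), pow_nonneg hy (α s(a, b))]
    · simp
  rw [Finset.sum_const, Finset.card_univ, nsmul_eq_mul, abs_mul] at h2
  have h5 : |l| ≤ 2 * Fintype.card V := le_of_mul_le_mul_right (by linarith) hpos
  exact (le_abs_self l).trans h5

open Classical in
lemma abs_sub_le_length_mul_sqrt (v : V → ℝ) {a b : V} (p : G.Walk a b) :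
    |v a - v b| ≤ p.length * √(∑ a, ∑ b, if G.Adj a b then (v a - v b) ^ 2 else 0) := by
  set E := ∑ a, ∑ b, if G.Adj a b then (v a - v b) ^ 2 else 0 with hE
  induction p with
  | nil => simp
  | @cons a c b h p ih =>
    have h0 : ∀ a b : V, 0 ≤ (if G.Adj a b then (v a - v b) ^ 2 else 0) := fun a b => by
      split_ifs <;> positivity
    have h1 : |v a - v c| ≤ √E := by
      refine Real.abs_le_sqrt ?_
      calc (v a - v c) ^ 2 = if G.Adj a c then (v a - v c) ^ 2 else 0 := by simp [h]
        _ ≤ ∑ b, if G.Adj a b then (v a - v b) ^ 2 else 0 :=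
            Finset.single_le_sum (f := fun b => if G.Adj a b then (v a - v b) ^ 2 else 0)
              (fun b _ => h0 a b) (Finset.mem_univ c)
        _ ≤ E := Finset.single_le_sum
              (f := fun a => ∑ b, if G.Adj a b then (v a - v b) ^ 2 else 0)
              (fun a _ => Finset.sum_nonneg fun b _ => h0 a b) (Finset.mem_univ a)
    have h2 := abs_sub_le (v a) (v c) (v b)
    rw [SimpleGraph.Walk.length_cons]
    push_cast
    linarith

open Classical in
/-- The Poincaré inequality on a connected graph. -/
lemma exists_poincare (hG : G.Connected) :
    ∃ c : ℝ, 0 < c ∧ ∀ v : V → ℝ, ∑ a, v a = 0 →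
      c * ∑ a, v a ^ 2 ≤ ∑ a, ∑ b, if G.Adj a b then (v a - v b) ^ 2 else 0 := by
  obtain ⟨a0⟩ := hG.nonempty
  set ℓ : ℕ := ∑ a, ∑ b, G.dist a b
  -- A path of length at most ℓ joins any two vertices, and each edge changes v by at most √E. As v
  -- has mean zero, every |v a| is at most (ℓ + 1)√E; squaring and summing over V gives the
  -- constant. The summand 1 keeps it finite when ℓ = 0.
  refine ⟨((Fintype.card V : ℝ) * (ℓ + 1) ^ 2)⁻¹, ?_, fun v hv => ?_⟩
  · have : 0 < Fintype.card V := Fintype.card_pos_iff.2 ⟨a0⟩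
    positivity
  have hn : 0 < (Fintype.card V : ℝ) := by
    exact_mod_cast Fintype.card_pos_iff.2 ⟨a0⟩
  have hE : 0 ≤ ∑ a, ∑ b, if G.Adj a b then (v a - v b) ^ 2 else 0 :=
    Finset.sum_nonneg fun a _ => Finset.sum_nonneg fun b _ => by split_ifs <;> positivity
  set E := ∑ a, ∑ b, if G.Adj a b then (v a - v b) ^ 2 else 0 with hEdef
  have h1 : ∀ a b, |v a - v b| ≤ (ℓ + 1) * √E := by
    intro a b
    obtain ⟨p, hp⟩ := hG.exists_walk_length_eq_dist a b
    refine (abs_sub_le_length_mul_sqrt v p).trans ?_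
    rw [← hEdef, hp]
    refine mul_le_mul_of_nonneg_right ?_ (Real.sqrt_nonneg _)
    have h2 : G.dist a b ≤ ℓ :=
      (Finset.single_le_sum (f := fun b => G.dist a b) (fun b _ => Nat.zero_le _)
        (Finset.mem_univ b)).trans
      (Finset.single_le_sum (f := fun a => ∑ b, G.dist a b) (fun b _ => Nat.zero_le _)
        (Finset.mem_univ a))
    have h3 : (G.dist a b : ℝ) ≤ ℓ := by exact_mod_cast h2
    linarith
  have h2 : ∀ a, v a ^ 2 ≤ (ℓ + 1) ^ 2 * E := by
    intro a
    have h3 : Fintype.card V * v a = ∑ b, (v a - v b) := by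
      rw [Finset.sum_sub_distrib, hv, Finset.sum_const, Finset.card_univ, nsmul_eq_mul, sub_zero]
    have h4 : Fintype.card V * |v a| ≤ Fintype.card V * ((ℓ + 1) * √E) := by
      calc Fintype.card V * |v a| = |Fintype.card V * v a| := by
            rw [abs_mul, abs_of_pos hn]
        _ ≤ ∑ b, |v a - v b| := by rw [h3]; exact Finset.abs_sum_le_sum_abs _ _
        _ ≤ ∑ _b : V, (ℓ + 1) * √E := Finset.sum_le_sum fun b _ => h1 a b
        _ = _ := by rw [Finset.sum_const, Finset.card_univ, nsmul_eq_mul]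
    have h5 : |v a| ≤ (ℓ + 1) * √E := le_of_mul_le_mul_left h4 hn
    calc v a ^ 2 = |v a| ^ 2 := (sq_abs _).symm
      _ ≤ ((ℓ + 1) * √E) ^ 2 := by gcongr
      _ = _ := by rw [mul_pow, Real.sq_sqrt hE]
  rw [inv_mul_le_iff₀ (by positivity)]
  calc ∑ a, v a ^ 2 ≤ ∑ _a : V, (ℓ + 1 : ℝ) ^ 2 * E := Finset.sum_le_sum fun a _ => h2 a
    _ = _ := by rw [Finset.sum_const, Finset.card_univ, nsmul_eq_mul]; ring

/-- The nonzero eigenvalues of `L(y)` grow at least linearly in `y`. -/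
lemma exists_mul_le_of_mem_realSpec (hG : G.Connected) (hα : ∀ e ∈ G.edgeSet, 0 < α e) :
    ∃ c : ℝ, 0 < c ∧ ∀ y : ℝ, 1 ≤ y → ∀ l ∈ realSpec G α y, l ≠ 0 → c * y ≤ l := by
  classical
  obtain ⟨c, hc, h⟩ := exists_poincare hG
  refine ⟨c / 2, by positivity, fun y hy l hl hl0 => ?_⟩
  obtain ⟨v, hv, hv2⟩ := exists_mulVec_eq_of_mem_realSpec hl
  have hsum : ∑ a, v a = 0 := by
    have h1 := sum_lapMatrix_mulVec (G := G) (α := α) y v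
    rw [hv2] at h1
    simp only [Pi.smul_apply, smul_eq_mul, ← Finset.mul_sum] at h1
    exact (mul_eq_zero.1 h1).resolve_left hl0
  have h1 := sum_mul_lapMatrix_mulVec (G := G) (α := α) y v
  rw [hv2, sum_mul_smul] at h1
  -- Positive exponents enter here: y^α ≥ y for y ≥ 1.
  have h2 : y * ∑ a, ∑ b, (if G.Adj a b then (v a - v b) ^ 2 else 0)
      ≤ ∑ a, ∑ b, if G.Adj a b then y ^ α s(a, b) * (v a - v b) ^ 2 else 0 := by
    rw [Finset.mul_sum]
    refine Finset.sum_le_sum fun a _ => ?_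
    rw [Finset.mul_sum]
    refine Finset.sum_le_sum fun b _ => ?_
    split_ifs with hab
    · exact mul_le_mul_of_nonneg_right (le_self_pow₀ hy (hα s(a, b) hab).ne') (sq_nonneg _)
    · simp
  have h3 := mul_le_mul_of_nonneg_left (h v hsum) (by linarith : 0 ≤ y)
  have h4 := sum_sq_pos hv
  refine le_of_mul_le_mul_right ?_ h4
  rw [h1]
  linarith

/-- Zero is a simple eigenvalue of the Laplacian matrix of a connected graph. -/
lemma count_zero_realSpec (hG : G.Connected) {y : ℝ} (hy : 0 < y) :
    (realSpec G α y).count 0 = 1 := by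
  classical
  have h0 := count_roots_charpoly_eq_finrank (lapMatrix_isHermitian (𝕜 := ℝ) G α y) 0
  rw [RCLike.ofReal_real_eq_id, id] at h0
  obtain ⟨a0⟩ := hG.nonempty
  -- A kernel vector has zero energy, so it is constant along edges and, by connectedness, constant.
  have h1 : LinearMap.ker (lapMatrix G α y - (0 : ℝ) • 1).mulVecLin
      = Submodule.span ℝ {fun _ : V => (1 : ℝ)} := by
    ext v
    rw [LinearMap.mem_ker, Matrix.mulVecLin_apply, zero_smul, sub_zero,
      Submodule.mem_span_singleton]
    constructor
    · intro hv
      have h2 := sum_mul_lapMatrix_mulVec (G := G) (α := α) y v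
      rw [hv] at h2
      simp only [Pi.zero_apply, mul_zero, Finset.sum_const_zero] at h2
      have hnn : ∀ a b, 0 ≤ (if G.Adj a b then y ^ α s(a, b) * (v a - v b) ^ 2 else 0) :=
        fun a b => by split_ifs <;> positivity
      have h3 : ∀ a b, G.Adj a b → v a = v b := by
        intro a b hab
        have h4 := (Finset.sum_eq_zero_iff_of_nonneg
          (fun a _ => Finset.sum_nonneg fun b _ => hnn a b)).1 (show _ = (0 : ℝ) by linarith) a
          (Finset.mem_univ a)
        have h5 := (Finset.sum_eq_zero_iff_of_nonneg (fun b _ => hnn a b)).1 h4 b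
          (Finset.mem_univ b)
        rw [if_pos hab] at h5
        have h6 := (mul_eq_zero.1 h5).resolve_left (by positivity)
        exact sub_eq_zero.1 (pow_eq_zero_iff two_ne_zero |>.1 h6)
      have h4 : ∀ a b, v a = v b := by
        intro a b
        obtain ⟨p⟩ := hG.preconnected a b
        induction p with
        | nil => rfl
        | cons h p ih => exact (h3 _ _ h).trans ih
      exact ⟨v a0, by ext a; simp [h4 a0 a]⟩
    · rintro ⟨c, rfl⟩
      ext a
      rw [lapMatrix_mulVec]
      simp
  rw [h1, finrank_span_singleton (fun h => one_ne_zero (congrFun h a0))] at h0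
  exact h0

end Eigenvalues

/-! ### Separating graphs by the union of their spectra. -/

section Separation

open scoped ENNReal

lemma tsum_count_mul (M : Multiset ℂ) (f : ℂ → ℝ≥0∞) :
    ∑' z, ((M.count z : ℕ∞) : ℝ≥0∞) * f z = (M.map f).sum := by
  rw [tsum_eq_sum (s := M.toFinset)]
  · rw [Finset.sum_multiset_map_count]
    simp [nsmul_eq_mul]
  · intro z hz
    rw [Multiset.mem_toFinset] at hz
    simp [Multiset.count_eq_zero_of_notMem hz]

/-- Multiplicities are moved to `ℝ≥0∞`, where they can be weighted by real numbers and sums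
interchange freely. -/
lemma toENNReal_tsum {ι : Type*} (f : ι → ℕ∞) :
    ((∑' i, f i : ℕ∞) : ℝ≥0∞) = ∑' i, (f i : ℝ≥0∞) := by
  have h : HasSum f (⨆ s : Finset ι, ∑ i ∈ s, f i) :=
    tendsto_atTop_iSup (Finset.sum_mono_set f)
  exact (h.summable.hasSum.map ENat.toENNRealRingHom ENat.continuous_toENNReal).tsum_eq.symm

variable {V : Type*} [Fintype V] {G G' : SimpleGraph V} {α : Sym2 V → ℕ}

variable (G α) in
/-- The sum of `1 / (l + t)` over the nonzero eigenvalues `l` of `L(y)`. -/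
def resolventSum (t : ℕ) (y : ℝ) : ℝ :=
  (((realSpec G α y).filter (· ≠ 0)).map fun l : ℝ => 1 / (l + (t : ℝ))).sum

lemma resolventSum_nonneg {t : ℕ} {y : ℝ} (hy : 0 ≤ y) : 0 ≤ resolventSum G α t y := by
  refine Multiset.sum_nonneg fun x hx => ?_
  obtain ⟨l, hl, rfl⟩ := Multiset.mem_map.1 hx
  have := nonneg_of_mem_realSpec hy (Multiset.mem_of_mem_filter hl)
  positivity

/-- There are at most |V| terms, each at most 1/(cy) by the linear growth of nonzero eigenvalues. -/
lemma exists_resolventSum_le (hG : G.Connected) (hα : ∀ e ∈ G.edgeSet, 0 < α e) (t : ℕ) :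
    ∃ c : ℝ, ∀ y : ℝ, 1 ≤ y → resolventSum G α t y ≤ c * y⁻¹ := by
  obtain ⟨c, hc, h⟩ := exists_mul_le_of_mem_realSpec hG hα
  refine ⟨Fintype.card V * c⁻¹, fun y hy => ?_⟩
  have hcard : Multiset.card ((realSpec G α y).filter (· ≠ 0)) ≤ Fintype.card V := by
    classical
    refine (Multiset.card_le_card (Multiset.filter_le _ _)).trans ?_
    refine (card_roots' _).trans (le_of_eq ?_)
    convert Matrix.charpoly_natDegree_eq_dim (lapMatrix G α y)
  have h1 : ∀ x ∈ ((realSpec G α y).filter (· ≠ 0)).map fun l : ℝ => 1 / (l + (t : ℝ)),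
      x ≤ (c * y)⁻¹ := by
    intro x hx
    obtain ⟨l, hl, rfl⟩ := Multiset.mem_map.1 hx
    have h2 := h y hy l (Multiset.mem_of_mem_filter hl) (Multiset.mem_filter.1 hl).2
    rw [one_div]
    refine inv_anti₀ (by positivity) (h2.trans ?_)
    simp
  refine (Multiset.sum_le_card_nsmul _ _ h1).trans ?_
  rw [Multiset.card_map, nsmul_eq_mul, mul_inv, ← mul_assoc]
  gcongr

lemma summable_resolventSum (hG : G.Connected) (hα : ∀ e ∈ G.edgeSet, 0 < α e) (t : ℕ)
    {q : ℝ} (hq : 1 < q) : Summable fun k : ℕ => resolventSum G α t (q ^ (k + 1)) := by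
  obtain ⟨c, h⟩ := exists_resolventSum_le hG hα t
  have hs : Summable fun k : ℕ => c * (q⁻¹) ^ (k + 1) :=
    ((summable_nat_add_iff 1).2 (summable_geometric_of_lt_one (by positivity)
      (inv_lt_one_of_one_lt₀ hq))).mul_left c
  refine Summable.of_nonneg_of_le (fun k => resolventSum_nonneg (by positivity)) (fun k => ?_) hs
  rw [inv_pow]
  exact h _ (one_le_pow₀ hq.le)

lemma tendsto_resolventSum (hG : G.Connected) (hα : ∀ e ∈ G.edgeSet, 0 < α e) (t : ℕ) :
    Tendsto (resolventSum G α t) atTop (𝓝 0) := by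
  obtain ⟨c, h⟩ := exists_resolventSum_le hG hα t
  have h1 : Tendsto (fun y : ℝ => c * y⁻¹) atTop (𝓝 0) := by
    simpa using tendsto_inv_atTop_zero.const_mul c
  refine tendsto_of_tendsto_of_tendsto_of_le_of_le' tendsto_const_nhds h1 ?_ ?_
  · filter_upwards [eventually_ge_atTop (0 : ℝ)] with y hy using resolventSum_nonneg hy
  · filter_upwards [eventually_ge_atTop (1 : ℝ)] with y hy using h y hy

/-- The value of the spectral polynomial at `X = -t`. -/
def evalNeg (P : ℤ[X][X]) (t : ℕ) : ℤ[X] := P.eval (-(t : ℤ[X]))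

open Classical in
lemma eval_charpoly_lapMatrix (t : ℕ) (y : ℝ) :
    (lapMatrix G α y).charpoly.eval (-(t : ℝ))
      = ((evalNeg (spectralPolynomial G α) t).map (Int.castRingHom ℝ)).eval y := by
  rw [charpoly_lapMatrix, evalNeg, eval_map, eval_map,
    show (-(t : ℝ)) = Polynomial.eval₂RingHom (Int.castRingHom ℝ) y (-(t : ℤ[X])) by simp,
    eval₂_at_apply]
  rfl

open Classical in
lemma eval_derivative_charpoly_lapMatrix (t : ℕ) (y : ℝ) :
    (derivative (lapMatrix G α y).charpoly).eval (-(t : ℝ))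
      = ((evalNeg (derivative (spectralPolynomial G α)) t).map (Int.castRingHom ℝ)).eval y := by
  rw [charpoly_lapMatrix, evalNeg, derivative_map, eval_map, eval_map,
    show (-(t : ℝ)) = Polynomial.eval₂RingHom (Int.castRingHom ℝ) y (-(t : ℤ[X])) by simp,
    eval₂_at_apply]
  rfl

lemma eval_evalNeg_ne_zero {t : ℕ} (ht : 0 < t) {y : ℝ} (hy : 0 ≤ y) :
    ((evalNeg (spectralPolynomial G α) t).map (Int.castRingHom ℝ)).eval y ≠ 0 := by
  classical
  rw [← eval_charpoly_lapMatrix]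
  intro h
  have h1 : (-(t : ℝ)) ∈ realSpec G α y := by
    rw [realSpec, mem_roots (Matrix.charpoly_monic _).ne_zero]
    exact h
  have h2 := nonneg_of_mem_realSpec hy h1
  have h3 : (0 : ℝ) < t := by exact_mod_cast ht
  linarith

/-- The logarithmic derivative at -t is the sum of 1/(-t - l) over all eigenvalues; the simple
eigenvalue 0 accounts for the separate 1/t. -/
lemma resolventSum_eq (hG : G.Connected) {t : ℕ} (ht : 0 < t) {y : ℝ} (hy : 0 < y) :
    resolventSum G α t y =
      -(((evalNeg (derivative (spectralPolynomial G α)) t).map (Int.castRingHom ℝ)).eval y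
        / ((evalNeg (spectralPolynomial G α) t).map (Int.castRingHom ℝ)).eval y) - 1 / t := by
  classical
  have h := eval_evalNeg_ne_zero (G := G) (α := α) ht hy.le
  rw [← eval_charpoly_lapMatrix] at h
  have h1 := (splits_charpoly_lapMatrix (G := G) (α := α) y).eval_derivative_div_eval_of_ne_zero h
  rw [← eval_charpoly_lapMatrix, ← eval_derivative_charpoly_lapMatrix, h1]
  have h2 : ((realSpec G α y).map fun l : ℝ => 1 / (l + (t : ℝ))).sum
      = resolventSum G α t y + 1 / t := by
    conv_lhs => rw [← Multiset.filter_add_not (fun l : ℝ => l ≠ 0) (realSpec G α y)]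
    rw [Multiset.map_add, Multiset.sum_add, resolventSum]
    congr 1
    have h3 : (realSpec G α y).filter (fun l : ℝ => ¬ l ≠ 0) = {0} := by
      simp only [not_not]
      rw [Multiset.filter_eq', count_zero_realSpec hG hy]
      rfl
    rw [h3]
    simp
  have h4 : ((lapMatrix G α y).charpoly.roots.map fun z => 1 / (-(t : ℝ) - z)).sum
      = -((realSpec G α y).map fun l : ℝ => 1 / (l + (t : ℝ))).sum := by
    rw [← Multiset.sum_map_neg, realSpec]
    congr 1
    refine Multiset.map_congr rfl fun z _ => ?_
    rw [← one_div_neg_eq_neg_one_div]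
    congr 1
    ring
  rw [h4, h2]
  ring

variable (G α) in
/-- The multiplicity function of the union of the multisets `Spec L_r`. -/
def unionCount (q : ℕ) (z : ℂ) : ℕ∞ := ∑' r : ℤ, ((specL q G α r).count z : ℕ∞)

/-- The function by which the eigenvalues of the large scales are weighted. -/
def weight (C t : ℕ) (z : ℂ) : ℝ≥0∞ :=
  if ‖z‖ ≤ C then 0 else ENNReal.ofReal (1 / (‖z‖ + t))

lemma sum_map_ofReal (M : Multiset ℝ) (hM : ∀ x ∈ M, 0 ≤ x) :
    (M.map ENNReal.ofReal).sum = ENNReal.ofReal M.sum := by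
  induction M using Multiset.induction with
  | empty => simp
  | cons a M ih =>
    have h1 : ∀ x ∈ M, 0 ≤ x := fun x hx => hM x (Multiset.mem_cons_of_mem hx)
    rw [Multiset.map_cons, Multiset.sum_cons, Multiset.sum_cons, ih h1,
      ENNReal.ofReal_add (hM a (Multiset.mem_cons_self a M)) (Multiset.sum_nonneg h1)]

/-- For r > 0 all edge weights are at most 1, so the whole spectrum lies below the cutoff. -/
lemma sum_map_weight_of_pos {q : ℕ} (hq : 2 ≤ q) {r : ℤ} (hr : 0 < r) (t : ℕ) :
    ((specL q G α r).map (weight (2 * Fintype.card V) t)).sum = 0 := by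
  refine Multiset.sum_eq_zero fun x hx => ?_
  obtain ⟨z, hz, rfl⟩ := Multiset.mem_map.1 hx
  rw [specL_eq_map_realSpec] at hz
  obtain ⟨l, hl, rfl⟩ := Multiset.mem_map.1 hz
  have hq1 : (1 : ℝ) ≤ q := by exact_mod_cast (by omega : 1 ≤ q)
  have h0 : (0 : ℝ) ≤ (q : ℝ) ^ (1 - r) := by positivity
  have h1 : (q : ℝ) ^ (1 - r) ≤ 1 := zpow_le_one_of_nonpos₀ hq1 (by omega)
  rw [weight, if_pos]
  rw [Complex.norm_real, Real.norm_eq_abs, abs_of_nonneg (nonneg_of_mem_realSpec h0 hl)]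
  simpa using le_of_mem_realSpec_of_le_one h0 h1 hl

/-- At scale r = -k one has y = q^(k+1) ≥ q, so nonzero eigenvalues are at least cq and pass the
cutoff, while the eigenvalue 0 is removed by it. -/
lemma sum_map_weight_of_nonpos {q : ℕ} {c : ℝ} (hc : 0 < c)
    (h : ∀ y : ℝ, 1 ≤ y → ∀ l ∈ realSpec G α y, l ≠ 0 → c * y ≤ l) (hq : 2 ≤ q)
    (hqc : 2 * Fintype.card V < c * q) (k t : ℕ) :
    ((specL q G α (-(k : ℤ))).map (weight (2 * Fintype.card V) t)).sum
      = ENNReal.ofReal (resolventSum G α t ((q : ℝ) ^ (k + 1))) := by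
  have hq1 : (1 : ℝ) ≤ q := by exact_mod_cast (by omega : 1 ≤ q)
  have hpow : (q : ℝ) ^ (1 - (-(k : ℤ))) = (q : ℝ) ^ (k + 1) := by
    rw [← zpow_natCast]
    congr 1
    push_cast
    ring
  have hy1 : (1 : ℝ) ≤ (q : ℝ) ^ (k + 1) := one_le_pow₀ hq1
  rw [specL_eq_map_realSpec, hpow, resolventSum, ← sum_map_ofReal, Multiset.map_map,
    Multiset.map_map]
  · set M := realSpec G α ((q : ℝ) ^ (k + 1))
    have h1 : ((M.filter fun l => ¬ l ≠ 0).map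
        (weight (2 * Fintype.card V) t ∘ ((↑) : ℝ → ℂ))).sum = 0 := by
      refine Multiset.sum_eq_zero fun x hx => ?_
      obtain ⟨l, hl, rfl⟩ := Multiset.mem_map.1 hx
      rw [not_not.1 (Multiset.mem_filter.1 hl).2]
      simp [weight]
    conv_lhs => rw [← Multiset.filter_add_not (fun l : ℝ => l ≠ 0) M]
    rw [Multiset.map_add, Multiset.sum_add, h1, add_zero]
    congr 1
    refine Multiset.map_congr rfl fun l hl => ?_
    have hl1 := Multiset.mem_of_mem_filter hl
    have hl0 : 0 ≤ l := nonneg_of_mem_realSpec (by positivity) hl1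
    have h2 := h _ hy1 l hl1 (Multiset.mem_filter.1 hl).2
    have h3 : (q : ℝ) ≤ (q : ℝ) ^ (k + 1) := le_self_pow₀ hq1 (Nat.succ_ne_zero k)
    have h4 : 2 * Fintype.card V < l := by nlinarith
    simp only [Function.comp_apply, weight, Complex.norm_real, Real.norm_eq_abs,
      abs_of_nonneg hl0]
    rw [if_neg]
    push_cast
    linarith
  · intro x hx
    obtain ⟨l, hl, rfl⟩ := Multiset.mem_map.1 hx
    have := nonneg_of_mem_realSpec (by positivity) (Multiset.mem_of_mem_filter hl)
    positivity

/-- The left side uses only the unsorted union, so the sum of the resolvents over large scales is an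
invariant of Spec Λ. -/
lemma tsum_unionCount_mul_weight {q : ℕ} {c : ℝ} (hc : 0 < c)
    (h : ∀ y : ℝ, 1 ≤ y → ∀ l ∈ realSpec G α y, l ≠ 0 → c * y ≤ l) (hq : 2 ≤ q)
    (hqc : 2 * Fintype.card V < c * q) (t : ℕ) :
    ∑' z, (unionCount G α q z : ℝ≥0∞) * weight (2 * Fintype.card V) t z
      = ∑' k : ℕ, ENNReal.ofReal (resolventSum G α t ((q : ℝ) ^ (k + 1))) := by
  simp only [unionCount, toENNReal_tsum, ← ENNReal.tsum_mul_right]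
  rw [ENNReal.tsum_comm]
  simp only [tsum_count_mul, ← sum_map_weight_of_nonpos hc h hq hqc]
  have hinj : Function.Injective fun k : ℕ => -(k : ℤ) := fun a b hab => by simpa using hab
  refine (hinj.tsum_eq (f := fun r : ℤ =>
    ((specL q G α r).map (weight (2 * Fintype.card V) t)).sum) ?_).symm
  intro r hr
  rcases le_or_gt r 0 with h0 | h0
  · exact ⟨r.natAbs, by simp only; omega⟩
  · exact absurd (sum_map_weight_of_pos hq h0 t) hr

/-- Graphs with different spectral polynomials are distinguished by the union of the spectra of
the matrices `L_r`, for each sufficiently large `q`. -/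
theorem exists_forall_unionCount_ne (hG : G.Connected) (hα : ∀ e ∈ G.edgeSet, 0 < α e)
    (hG' : G'.Connected) (hα' : ∀ e ∈ G'.edgeSet, 0 < α e)
    (hne : spectralPolynomial G α ≠ spectralPolynomial G' α) :
    ∃ Q : ℕ, ∀ q : ℕ, Q ≤ q → unionCount G α q ≠ unionCount G' α q := by
  set P := spectralPolynomial G α with hP
  set P' := spectralPolynomial G' α with hP'
  have hne2 : derivative P * P' - P * derivative P' ≠ 0 := by
    refine fun h => hne (eq_of_derivative_mul_eq (spectralPolynomial_monic G α)
      (spectralPolynomial_monic G' α) ?_ (sub_eq_zero.1 h))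
    rw [spectralPolynomial_natDegree, spectralPolynomial_natDegree]
  obtain ⟨t, ht, hN⟩ := exists_nat_eval_ne_zero hne2
  set φ := Int.castRingHom ℝ
  set A := (evalNeg (derivative P) t).map φ with hA
  set B := (evalNeg P t).map φ with hB
  set A' := (evalNeg (derivative P') t).map φ with hA'
  set B' := (evalNeg P' t).map φ with hB'
  have hN0 : A * B' - B * A' ≠ 0 := by
    have h1 : A * B' - B * A'
        = ((derivative P * P' - P * derivative P').eval (-(t : ℤ[X]))).map φ := by
      simp [hA, hB, hA', hB', evalNeg]
    rw [h1]
    exact (Polynomial.map_ne_zero_iff Int.cast_injective).2 hN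
  have hBy : ∀ y : ℝ, 0 < y → B.eval y ≠ 0 := fun y hy => eval_evalNeg_ne_zero ht hy.le
  have hBy' : ∀ y : ℝ, 0 < y → B'.eval y ≠ 0 := fun y hy => eval_evalNeg_ne_zero ht hy.le
  have hM0 : B * B' ≠ 0 := mul_ne_zero (fun h => hBy 1 one_pos (by simp [h]))
    (fun h => hBy' 1 one_pos (by simp [h]))
  have hD : ∀ y : ℝ, 0 < y → (A * B' - B * A').eval y / (B * B').eval y
      = resolventSum G' α t y - resolventSum G α t y := by
    intro y hy
    have h1 := hBy y hy
    have h2 := hBy' y hy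
    rw [resolventSum_eq hG ht hy, resolventSum_eq hG' ht hy]
    simp only [← hP, ← hP']
    change _ = -(A'.eval y / B'.eval y) - 1 / t - (-(A.eval y / B.eval y) - 1 / t)
    rw [eval_sub, eval_mul, eval_mul, eval_mul]
    field_simp
    ring
  -- The degree inequality is read off from the decay of both resolvent sums.
  have hdeg : (A * B' - B * A').degree < (B * B').degree := by
    rw [← Polynomial.div_tendsto_atTop_zero_iff_degree_lt _ _ hM0]
    have h1 := (tendsto_resolventSum hG' hα' t).sub (tendsto_resolventSum hG hα t)
    rw [sub_zero] at h1
    refine h1.congr' ?_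
    filter_upwards [eventually_gt_atTop (0 : ℝ)] with y hy using (hD y hy).symm
  obtain ⟨c, hc, h⟩ := exists_mul_le_of_mem_realSpec hG hα
  obtain ⟨c', hc', h'⟩ := exists_mul_le_of_mem_realSpec hG' hα'
  have hlin : ∀ c : ℝ, 0 < c → ∀ᶠ q : ℝ in atTop, 2 * Fintype.card V < c * q := fun c hc =>
    (tendsto_id.const_mul_atTop hc).eventually_gt_atTop _
  have hev := (tendsto_natCast_atTop_atTop (R := ℝ)).eventually
    (((eventually_tsum_div_ne_zero hN0 hM0 hdeg).and ((hlin c hc).and (hlin c' hc'))).and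
      (eventually_ge_atTop 2))
  obtain ⟨Q, hQ⟩ := eventually_atTop.1 hev
  refine ⟨Q, fun q hq heq => ?_⟩
  obtain ⟨⟨h1, h2, h3⟩, h4⟩ := hQ q hq
  have hq2 : 2 ≤ q := by exact_mod_cast h4
  have hq1 : (1 : ℝ) < q := by linarith
  have h5 := tsum_unionCount_mul_weight hc h hq2 h2 t
  rw [heq, tsum_unionCount_mul_weight hc' h' hq2 h3 t] at h5
  have hs := summable_resolventSum hG hα t hq1
  have hs' := summable_resolventSum hG' hα' t hq1
  rw [← ENNReal.ofReal_tsum_of_nonneg (fun k => resolventSum_nonneg (by positivity)) hs,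
    ← ENNReal.ofReal_tsum_of_nonneg (fun k => resolventSum_nonneg (by positivity)) hs',
    ENNReal.ofReal_eq_ofReal_iff (tsum_nonneg fun k => resolventSum_nonneg (by positivity))
      (tsum_nonneg fun k => resolventSum_nonneg (by positivity))] at h5
  -- Equal unions would make D sum to zero along the powers of q.
  refine h1 ?_
  have h6 := hs'.hasSum.sub hs.hasSum
  rw [h5, sub_self] at h6
  exact h6.congr_fun fun k => hD _ (by positivity)

end Separation

/-! ### The residue field and the value group. -/

section Field

variable {K : Type*} [NontriviallyNormedField K] [IsUltrametricDist K] [MeasurableSpace K]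
  {p : ℕ} {μ : Measure K} {χ : AddChar K Circle}

lemma IsNormalized.two_le_residueCard (hK : IsNormalized p μ χ) : 2 ≤ residueCard K := by
  obtain ⟨ϖ, hϖ, h⟩ := hK.exists_uniformizer
  obtain ⟨x, hx0, hx1⟩ := NormedField.exists_norm_lt_one K
  -- `Nat.card` would be 0 for an infinite residue field; the uniformizer would then have norm 0⁻¹ =
  -- 0, against nontriviality of the norm.
  have h0 : residueCard K ≠ 0 := by
    intro h0
    have := h x hx1
    rw [hϖ, h0] at this
    simp only [Nat.cast_zero, inv_zero] at this
    linarith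
  have h1 : residueCard K ≠ 1 := by
    intro h1
    rw [residueCard, Nat.card_eq_one_iff_unique] at h1
    exact not_subsingleton _ h1.1
  omega

lemma IsNormalized.one_lt_residueCard (hK : IsNormalized p μ χ) : (1 : ℝ) < residueCard K := by
  exact_mod_cast hK.two_le_residueCard

/-- The residue field has characteristic p, so p divides its order. This makes q_p unbounded as p
varies. -/
lemma IsNormalized.le_residueCard (hK : IsNormalized p μ χ) (hp : p.Prime) :
    p ≤ residueCard K := by
  set O := (NormedField.valuation (K := K)).integer
  have h1 : IsLocalRing.residue O (p : O) = 0 := by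
    rw [IsLocalRing.residue_eq_zero_iff, IsLocalRing.mem_maximalIdeal, mem_nonunits_iff]
    intro hu
    obtain ⟨y, hy⟩ := hu.exists_right_inv
    have hy1 : ‖(y : K)‖ ≤ 1 := y.2
    have hy2 : (p : K) * (y : K) = 1 := by
      have := congrArg (Subtype.val) hy
      simpa using this
    have h3 := congrArg norm hy2
    rw [norm_mul, norm_one] at h3
    nlinarith [hK.norm_p_lt_one, norm_nonneg (y : K), norm_nonneg (p : K)]
  have := Fact.mk hp
  have h2 : addOrderOf (1 : IsLocalRing.ResidueField O) = p := by
    refine addOrderOf_eq_prime ?_ one_ne_zero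
    rw [nsmul_one, ← map_natCast (IsLocalRing.residue O), h1]
  have h3 : p ∣ residueCard K := h2 ▸ addOrderOf_dvd_natCard _
  exact Nat.le_of_dvd (by have := hK.two_le_residueCard; omega) h3

lemma IsNormalized.exists_norm_eq_zpow (hK : IsNormalized p μ χ) (k : ℤ) :
    ∃ x : K, x ≠ 0 ∧ ‖x‖ = (residueCard K : ℝ) ^ k := by
  obtain ⟨ϖ, hϖ, -⟩ := hK.exists_uniformizer
  have hq := hK.one_lt_residueCard
  refine ⟨ϖ ^ (-k), ?_, by rw [norm_zpow, hϖ, inv_zpow', neg_neg]⟩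
  rw [← norm_pos_iff, norm_zpow, hϖ]
  positivity

lemma IsNormalized.norm_eq_zpow (hK : IsNormalized p μ χ) {x : K} (hx : x ≠ 0) :
    ∃ k : ℤ, ‖x‖ = (residueCard K : ℝ) ^ k := by
  obtain ⟨ϖ, hϖ, h⟩ := hK.exists_uniformizer
  have hq := hK.one_lt_residueCard
  have hq0 : (0 : ℝ) < residueCard K := by linarith
  obtain ⟨k, hk1, hk2⟩ := exists_mem_Ico_zpow (norm_pos_iff.2 hx) hq
  refine ⟨k, le_antisymm ?_ hk1⟩
  -- Rescaled into the maximal ideal, the element has norm at most 1/q, which excludes norms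
  -- strictly between q^k and q^(k+1).
  have h1 : ‖x * ϖ ^ (k + 1)‖ < 1 := by
    rw [norm_mul, norm_zpow, hϖ, inv_zpow, ← div_eq_mul_inv, div_lt_one (by positivity)]
    exact hk2
  have h2 := h _ h1
  rw [norm_mul, norm_zpow, hϖ, inv_zpow, ← div_eq_mul_inv, div_le_iff₀ (by positivity),
    zpow_add_one₀ hq0.ne'] at h2
  refine h2.trans (le_of_eq ?_)
  field_simp

end Field

/-! ### Linearity and uniqueness of the Fourier transform on L². -/

section Fourier

open scoped ENNReal

variable {K : Type*} [NontriviallyNormedField K] [MeasurableSpace K]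
  {μ : Measure K} {χ : AddChar K Circle}

variable (μ χ) in
/-- The Fourier integral of `f` over the ball of radius `N`. -/
def truncFourier (N : ℕ) (f : K → ℂ) (ξ : K) : ℂ :=
  ∫ x in Metric.closedBall (0 : K) N, (χ (ξ * x) : ℂ) * f x ∂μ

lemma isFourier_iff {f g : Lp ℂ 2 μ} : IsFourier μ χ f g ↔
    Tendsto (fun N : ℕ => eLpNorm (fun ξ => truncFourier μ χ N f ξ - g ξ) 2 μ) atTop (𝓝 0) :=
  Iff.rfl

lemma truncFourier_congr {N : ℕ} {f g : K → ℂ} (h : f =ᵐ[μ] g) (ξ : K) :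
    truncFourier μ χ N f ξ = truncFourier μ χ N g ξ :=
  integral_congr_ae ((ae_restrict_of_ae h).mono fun x hx => by simp only [hx])

lemma truncFourier_const_mul (N : ℕ) (c : ℂ) (f : K → ℂ) (ξ : K) :
    truncFourier μ χ N (fun x => c * f x) ξ = c * truncFourier μ χ N f ξ := by
  rw [truncFourier, truncFourier, ← integral_const_mul]
  congr 1
  ext x
  ring

lemma IsFourier.zero : IsFourier μ χ (0 : Lp ℂ 2 μ) 0 := by
  rw [isFourier_iff]
  refine tendsto_const_nhds.congr fun N => ?_
  have h : (fun ξ => truncFourier μ χ N ((0 : Lp ℂ 2 μ) : K → ℂ) ξ - (0 : Lp ℂ 2 μ) ξ)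
      =ᵐ[μ] 0 := by
    filter_upwards [Lp.coeFn_zero ℂ 2 μ] with ξ hξ
    rw [hξ, truncFourier_congr (Lp.coeFn_zero ℂ 2 μ)]
    simp [truncFourier]
  rw [eLpNorm_congr_ae h, eLpNorm_zero]

lemma IsFourier.smul {f g : Lp ℂ 2 μ} (h : IsFourier μ χ f g) (c : ℂ) :
    IsFourier μ χ (c • f) (c • g) := by
  rw [isFourier_iff] at h ⊢
  have h1 := ENNReal.Tendsto.const_mul h (a := ‖c‖ₑ) (Or.inr enorm_ne_top)
  rw [mul_zero] at h1
  refine h1.congr fun N => ?_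
  rw [← eLpNorm_const_smul]
  refine eLpNorm_congr_ae ?_
  filter_upwards [Lp.coeFn_smul c g] with ξ hξ
  rw [hξ, truncFourier_congr (Lp.coeFn_smul c f)]
  simp only [Pi.smul_apply, smul_eq_mul, mul_sub]
  congr 1
  exact (truncFourier_const_mul N c f ξ).symm

lemma integrable_char_mul [BorelSpace K] (hχ : Continuous χ) (ξ : K) {f : K → ℂ} {s : Set K}
    (hf : IntegrableOn f s μ) : IntegrableOn (fun x => (χ (ξ * x) : ℂ) * f x) s μ := by
  refine Integrable.bdd_mul (c := 1) hf ?_ ?_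
  · exact (by fun_prop : Continuous fun x => (χ (ξ * x) : ℂ)).aestronglyMeasurable
  · exact Eventually.of_forall fun x => (Circle.norm_coe _).le

lemma IsFourier.eq_zero {g : Lp ℂ 2 μ} (h : IsFourier μ χ 0 g) : g = 0 := by
  rw [isFourier_iff] at h
  have h1 : ∀ N, eLpNorm (fun ξ => truncFourier μ χ N ((0 : Lp ℂ 2 μ) : K → ℂ) ξ - g ξ) 2 μ
      = eLpNorm g 2 μ := by
    intro N
    rw [← eLpNorm_neg]
    congr 1
    ext ξ
    rw [Pi.neg_apply, truncFourier_congr (Lp.coeFn_zero ℂ 2 μ)]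
    simp [truncFourier]
  simp only [h1] at h
  have h2 := tendsto_nhds_unique h tendsto_const_nhds
  exact (Lp.eq_zero_iff_ae_eq_zero).2
    ((eLpNorm_eq_zero_iff (Lp.aestronglyMeasurable g) two_ne_zero).1 h2.symm)

variable [ProperSpace K] [μ.IsAddHaarMeasure]

lemma integrableOn_closedBall (f : Lp ℂ 2 μ) (a : K) (R : ℝ) :
    IntegrableOn f (Metric.closedBall a R) μ := by
  have : IsFiniteMeasure (μ.restrict (Metric.closedBall a R)) :=
    ⟨by rw [Measure.restrict_apply_univ]; exact (isCompact_closedBall a R).measure_lt_top⟩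
  exact ((Lp.memLp f).restrict _).integrable one_le_two

variable [BorelSpace K]

lemma continuous_truncFourier (hχ : Continuous χ) (N : ℕ) (f : Lp ℂ 2 μ) :
    Continuous (truncFourier μ χ N f) := by
  have hf := integrableOn_closedBall f 0 N
  refine continuous_of_dominated (bound := fun x => ‖f x‖) ?_ ?_ hf.norm ?_
  · exact fun ξ => (integrable_char_mul hχ ξ hf).aestronglyMeasurable
  · refine fun ξ => Eventually.of_forall fun x => ?_
    rw [norm_mul, Circle.norm_coe, one_mul]
  · exact Eventually.of_forall fun x => by fun_prop

lemma truncFourier_add (hχ : Continuous χ) (N : ℕ) (f g : Lp ℂ 2 μ) (ξ : K) :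
    truncFourier μ χ N (f + g : Lp ℂ 2 μ) ξ
      = truncFourier μ χ N f ξ + truncFourier μ χ N g ξ := by
  rw [truncFourier_congr (Lp.coeFn_add f g), truncFourier, truncFourier, truncFourier,
    ← integral_add (integrable_char_mul hχ ξ (integrableOn_closedBall f 0 N))
      (integrable_char_mul hχ ξ (integrableOn_closedBall g 0 N))]
  congr 1
  ext x
  simp [mul_add]

lemma aestronglyMeasurable_truncFourier_sub (hχ : Continuous χ) (N : ℕ) (f g : Lp ℂ 2 μ) :
    AEStronglyMeasurable (fun ξ => truncFourier μ χ N f ξ - g ξ) μ :=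
  (continuous_truncFourier hχ N f).aestronglyMeasurable.sub (Lp.aestronglyMeasurable g)

lemma IsFourier.add (hχ : Continuous χ) {f g f' g' : Lp ℂ 2 μ} (h : IsFourier μ χ f g)
    (h' : IsFourier μ χ f' g') : IsFourier μ χ (f + f') (g + g') := by
  rw [isFourier_iff] at h h' ⊢
  have h1 := h.add h'
  rw [add_zero] at h1
  refine tendsto_of_tendsto_of_tendsto_of_le_of_le tendsto_const_nhds h1 (fun _ => zero_le) ?_
  intro N
  refine le_trans (le_of_eq ?_) (eLpNorm_add_le (aestronglyMeasurable_truncFourier_sub hχ N f g)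
    (aestronglyMeasurable_truncFourier_sub hχ N f' g') one_le_two)
  refine eLpNorm_congr_ae ?_
  filter_upwards [Lp.coeFn_add g g'] with ξ hξ
  rw [hξ, truncFourier_add hχ]
  simp only [Pi.add_apply]
  ring

lemma IsFourier.sub (hχ : Continuous χ) {f g f' g' : Lp ℂ 2 μ} (h : IsFourier μ χ f g)
    (h' : IsFourier μ χ f' g') : IsFourier μ χ (f - f') (g - g') := by
  have h1 := h.add hχ (h'.smul (-1))
  simpa [sub_eq_add_neg] using h1

lemma IsFourier.sum (hχ : Continuous χ) {ι : Type*} (s : Finset ι) {f g : ι → Lp ℂ 2 μ}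
    (h : ∀ i, IsFourier μ χ (f i) (g i)) : IsFourier μ χ (∑ i ∈ s, f i) (∑ i ∈ s, g i) := by
  classical
  induction s using Finset.induction_on with
  | empty => exact IsFourier.zero
  | insert i s hi ih =>
    rw [Finset.sum_insert hi, Finset.sum_insert hi]
    exact (h i).add hχ ih

/-- The Fourier transform of a function in `L²` is unique. -/
lemma IsFourier.unique (hχ : Continuous χ) {f g g' : Lp ℂ 2 μ} (h : IsFourier μ χ f g)
    (h' : IsFourier μ χ f g') : g = g' := by
  have h1 := h.sub hχ h'
  rw [sub_self] at h1
  exact sub_eq_zero.1 h1.eq_zero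

end Fourier

/-! ### Functions with vanishing integrals over balls. -/

section Balls

variable {K : Type*} [NontriviallyNormedField K] [IsUltrametricDist K]

variable (K) in
/-- The balls whose radius is the norm of an element, and the empty set. -/
def valueBalls : Set (Set K) := insert ∅ {s | ∃ a c : K, c ≠ 0 ∧ s = Metric.closedBall a ‖c‖}

/-- Ultrametric balls are nested or disjoint, so these sets form a π-system, which generates the
Borel σ-algebra. -/
lemma inter_mem_valueBalls {s t : Set K} (hs : s ∈ valueBalls K) (ht : t ∈ valueBalls K) :
    s ∩ t ∈ valueBalls K := by
  rcases hs with rfl | ⟨a, c, hc, rfl⟩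
  · exact Or.inl (Set.empty_inter _)
  rcases ht with rfl | ⟨b, d, hd, rfl⟩
  · exact Or.inl (Set.inter_empty _)
  rcases IsUltrametricDist.closedBall_subset_trichotomy (x := a) (y := b) (r := ‖c‖) (s := ‖d‖)
    with h | h | h
  · rw [Set.inter_eq_left.2 h]; exact Or.inr ⟨a, c, hc, rfl⟩
  · rw [Set.inter_eq_right.2 h]; exact Or.inr ⟨b, d, hd, rfl⟩
  · exact Or.inl h.inter_eq

variable [ProperSpace K]

lemma borel_eq_generateFrom_valueBalls : borel K = MeasurableSpace.generateFrom (valueBalls K) := by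
  refine (TopologicalSpace.isTopologicalBasis_of_isOpen_of_nhds ?_ ?_).borel_eq_generateFrom
  · rintro s (rfl | ⟨a, c, hc, rfl⟩)
    · exact isOpen_empty
    · exact IsUltrametricDist.isOpen_closedBall a (norm_ne_zero_iff.2 hc)
  · intro a u ha hu
    obtain ⟨ε, hε, h⟩ := Metric.isOpen_iff.1 hu a ha
    obtain ⟨c, hc0, hc⟩ := NormedField.exists_norm_lt K hε
    exact ⟨_, Or.inr ⟨a, c, norm_pos_iff.1 hc0, rfl⟩, Metric.mem_closedBall_self (norm_nonneg c),
      (Metric.closedBall_subset_ball hc).trans h⟩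

variable [MeasurableSpace K] [BorelSpace K] {μ : Measure K}

lemma ae_restrict_eq_zero_of_forall_closedBall {f : K → ℂ}
    (h : ∀ a c : K, c ≠ 0 → ∫ x in Metric.closedBall a ‖c‖, f x ∂μ = 0) {a c : K} (hc : c ≠ 0)
    (hf : IntegrableOn f (Metric.closedBall a ‖c‖) μ) :
    ∀ᵐ x ∂μ.restrict (Metric.closedBall a ‖c‖), f x = 0 := by
  set B := Metric.closedBall a ‖c‖ with hB
  have hBm : MeasurableSet B := Metric.isClosed_closedBall.measurableSet
  -- Dynkin's π-λ argument, confined to a ball on which f is integrable.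
  have key : ∀ s, MeasurableSet s → ∫ x in s, f x ∂μ.restrict B = 0 := by
    refine MeasurableSpace.induction_on_inter (s := valueBalls K) ?_ ?_ ?_ ?_ ?_ ?_
    · rw [← borel_eq_generateFrom_valueBalls]
      exact BorelSpace.measurable_eq
    · exact fun s hs t ht _ => inter_mem_valueBalls hs ht
    · simp
    · intro t ht
      have htm : MeasurableSet t := by
        rcases ht with rfl | ⟨b, d, hd, rfl⟩
        · exact MeasurableSet.empty
        · exact Metric.isClosed_closedBall.measurableSet
      rw [Measure.restrict_restrict htm]
      rcases inter_mem_valueBalls ht (Or.inr ⟨a, c, hc, rfl⟩ : B ∈ valueBalls K)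
        with h1 | ⟨b, d, hd, h1⟩
      · rw [h1]; simp
      · rw [h1]; exact h b d hd
    · intro t ht h1
      rw [setIntegral_compl ht hf, h1, hB, h a c hc, sub_zero]
    · intro g hg hgm h1
      rw [integral_iUnion hgm hg hf.integrableOn]
      simp [h1]
  exact Integrable.ae_eq_zero_of_forall_setIntegral_eq_zero hf fun s hs _ => key s hs

/-- A function on `K` whose integral over each ball vanishes is zero almost everywhere. -/
lemma ae_eq_zero_of_forall_closedBall {f : K → ℂ}
    (hf : ∀ a : K, ∀ R : ℝ, IntegrableOn f (Metric.closedBall a R) μ)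
    (h : ∀ a c : K, c ≠ 0 → ∫ x in Metric.closedBall a ‖c‖, f x ∂μ = 0) : f =ᵐ[μ] 0 := by
  obtain ⟨c, hc⟩ := NormedField.exists_one_lt_norm K
  have hc0 : c ≠ 0 := norm_pos_iff.1 (by linarith)
  have hU : ⋃ n : ℕ, Metric.closedBall (0 : K) ‖c ^ n‖ = Set.univ := by
    refine Set.eq_univ_of_forall fun x => ?_
    obtain ⟨n, hn⟩ := pow_unbounded_of_one_lt ‖x‖ hc
    refine Set.mem_iUnion.2 ⟨n, ?_⟩
    rw [mem_closedBall_zero_iff, norm_pow]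
    exact hn.le
  have h1 : ∀ᵐ x ∂μ.restrict (⋃ n : ℕ, Metric.closedBall (0 : K) ‖c ^ n‖), f x = 0 :=
    (ae_restrict_iUnion_iff _ _).2 fun n =>
      ae_restrict_eq_zero_of_forall_closedBall h (pow_ne_zero n hc0) (hf 0 _)
  rw [hU, Measure.restrict_univ] at h1
  exact h1

end Balls

/-! ### Character integrals and functions of a given scale. -/

section Characters

lemma measureReal_closedBall_pos {K : Type*} [NontriviallyNormedField K]
    [MeasurableSpace K] [ProperSpace K] {μ : Measure K} [μ.IsAddHaarMeasure] (a : K) {R : ℝ}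
    (hR : 0 < R) :
    0 < μ.real (Metric.closedBall a R) :=
  ENNReal.toReal_pos (Metric.measure_closedBall_pos μ a hR).ne'
    (isCompact_closedBall a R).measure_lt_top.ne

variable {K : Type*} [NontriviallyNormedField K] [IsUltrametricDist K] [MeasurableSpace K]
  {p : ℕ} {μ : Measure K} {χ : AddChar K Circle}

/-- By discreteness of the value group a product of norms exceeding 1 is at least q, so a point
where χ is nontrivial can be rescaled by ξ⁻¹ into the ball. -/
lemma IsNormalized.exists_char_mul_ne_one (hK : IsNormalized p μ χ) {ξ c : K} (h : 1 < ‖ξ‖ * ‖c‖) :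
    ∃ x, ‖x‖ ≤ ‖c‖ ∧ χ (ξ * x) ≠ 1 := by
  obtain ⟨x, hx, hχ⟩ := hK.char_nontrivial
  have hq := hK.one_lt_residueCard
  have hξ : ξ ≠ 0 := by rintro rfl; simp at h; linarith
  have hc : c ≠ 0 := by rintro rfl; simp at h; linarith
  refine ⟨ξ⁻¹ * x, ?_, by rwa [mul_inv_cancel_left₀ hξ]⟩
  obtain ⟨k, hk⟩ := hK.norm_eq_zpow (mul_ne_zero hξ hc)
  rw [norm_mul] at hk
  have hk1 : (1 : ℤ) ≤ k := by
    rw [hk] at h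
    by_contra hk0
    exact absurd (zpow_le_one_of_nonpos₀ hq.le (by omega)) (not_le.2 h)
  have h1 : (residueCard K : ℝ) ≤ ‖ξ‖ * ‖c‖ := by
    rw [hk]
    calc (residueCard K : ℝ) = (residueCard K : ℝ) ^ (1 : ℤ) := (zpow_one _).symm
      _ ≤ _ := zpow_le_zpow_right₀ hq.le hk1
  rw [norm_mul, norm_inv, inv_mul_le_iff₀ (norm_pos_iff.2 hξ)]
  exact hx.trans h1

/-- The integral of a character over a ball around zero. -/
lemma IsNormalized.setIntegral_char_mul [BorelSpace K] (hK : IsNormalized p μ χ) (ξ c : K) :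
    ∫ x in Metric.closedBall (0 : K) ‖c‖, (χ (ξ * x) : ℂ) ∂μ
      = if ‖ξ‖ * ‖c‖ ≤ 1 then (μ.real (Metric.closedBall (0 : K) ‖c‖) : ℂ) else 0 := by
  have := hK.isAddHaar
  have hBm : MeasurableSet (Metric.closedBall (0 : K) ‖c‖) :=
    Metric.isClosed_closedBall.measurableSet
  split_ifs with h
  · have h1 : ∫ x in Metric.closedBall (0 : K) ‖c‖, (χ (ξ * x) : ℂ) ∂μ
        = ∫ x in Metric.closedBall (0 : K) ‖c‖, (1 : ℂ) ∂μ := by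
      refine setIntegral_congr_fun hBm fun x hx => ?_
      rw [mem_closedBall_zero_iff] at hx
      have h2 : χ (ξ * x) = 1 := by
        refine hK.char_integers _ ?_
        rw [norm_mul]
        exact (mul_le_mul_of_nonneg_left hx (norm_nonneg ξ)).trans h
      simp only [h2, Circle.coe_one]
    rw [h1, setIntegral_const]
    simp
  · obtain ⟨x0, hx0, hχ⟩ := hK.exists_char_mul_ne_one (not_le.1 h)
    set F : K → ℂ := (Metric.closedBall (0 : K) ‖c‖).indicator fun x => (χ (ξ * x) : ℂ) with hF
    -- Translation by x0 preserves the ball and multiplies the integrand by a constant other than 1,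
    -- so the integral vanishes.
    have h1 : ∀ x, F (x + x0) = (χ (ξ * x0) : ℂ) * F x := by
      intro x
      have h2 : x + x0 ∈ Metric.closedBall (0 : K) ‖c‖ ↔ x ∈ Metric.closedBall (0 : K) ‖c‖ := by
        simp only [mem_closedBall_zero_iff]
        constructor
        · intro h3
          have h4 := IsUltrametricDist.norm_add_le_max (x + x0) (-x0)
          rw [add_neg_cancel_right, norm_neg] at h4
          exact h4.trans (max_le h3 hx0)
        · intro h3
          exact (IsUltrametricDist.norm_add_le_max x x0).trans (max_le h3 hx0)
      by_cases h5 : x ∈ Metric.closedBall (0 : K) ‖c‖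
      · rw [hF, Set.indicator_of_mem (h2.2 h5), Set.indicator_of_mem h5, mul_add,
          AddChar.map_add_eq_mul, Circle.coe_mul, mul_comm]
      · rw [hF, Set.indicator_of_notMem (mt h2.1 h5), Set.indicator_of_notMem h5, mul_zero]
    have h2 := integral_add_right_eq_self (μ := μ) F x0
    simp only [h1] at h2
    rw [integral_const_mul] at h2
    rw [← integral_indicator hBm]
    change ∫ x, F x ∂μ = 0
    have h3 : ((χ (ξ * x0) : ℂ) - 1) * ∫ x, F x ∂μ = 0 := by rw [sub_mul, h2, one_mul, sub_self]
    refine (mul_eq_zero.1 h3).resolve_left fun h4 => hχ ?_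
    exact Circle.ext (by rw [sub_eq_zero.1 h4, Circle.coe_one])

variable [ProperSpace K] [BorelSpace K]

/-- For each `k` there is a function whose Fourier transform is nonzero and is supported on the
elements of norm `q ^ k`. -/
lemma IsNormalized.exists_isFourier (hK : IsNormalized p μ χ) (k : ℤ) :
    ∃ ψ u : Lp ℂ 2 μ, IsFourier μ χ ψ u ∧ u ≠ 0 ∧
      ∀ᵐ ξ ∂μ, u ξ ≠ 0 → ‖ξ‖ = (residueCard K : ℝ) ^ k := by
  have := hK.isAddHaar
  -- The function x ↦ χ(ηx) cut off to the ball of radius q^(1-k) has as transform a multiple of the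
  -- indicator of the ball around -η of radius q^(k-1). This radius is below ‖η‖ = q^k, so the norm
  -- is constant there.
  obtain ⟨η, hη0, hη⟩ := hK.exists_norm_eq_zpow k
  obtain ⟨c, hc0, hc⟩ := hK.exists_norm_eq_zpow (1 - k)
  have hq := hK.one_lt_residueCard
  have hq0 : (0 : ℝ) < residueCard K := by linarith
  set B := Metric.closedBall (0 : K) ‖c‖ with hB
  have hBm : MeasurableSet B := Metric.isClosed_closedBall.measurableSet
  have hBtop : μ B ≠ ⊤ := (isCompact_closedBall _ _).measure_lt_top.ne
  set B' := Metric.closedBall (-η) ‖c‖⁻¹ with hB'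
  have hB'm : MeasurableSet B' := Metric.isClosed_closedBall.measurableSet
  have hB'top : μ B' ≠ ⊤ := (isCompact_closedBall _ _).measure_lt_top.ne
  have hmem : MemLp (B.indicator fun x => (χ (η * x) : ℂ)) 2 μ := by
    have h1 : MemLp (B.indicator fun _ => (1 : ℂ)) 2 μ :=
      memLp_indicator_const 2 hBm 1 (Or.inr hBtop)
    have hχ := hK.continuous_char
    refine h1.mono ?_ (Eventually.of_forall fun x => ?_)
    · exact ((by fun_prop : Continuous fun x => (χ (η * x) : ℂ)).aestronglyMeasurable).indicator hBm
    · by_cases hx : x ∈ B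
      · rw [Set.indicator_of_mem hx, Set.indicator_of_mem hx, Circle.norm_coe, norm_one]
      · rw [Set.indicator_of_notMem hx, Set.indicator_of_notMem hx]
  set m : ℂ := (μ.real B : ℂ) with hm
  have hm0 : m ≠ 0 := Complex.ofReal_ne_zero.2
    (measureReal_closedBall_pos (μ := μ) (0 : K) (norm_pos_iff.2 hc0)).ne'
  set ψ : Lp ℂ 2 μ := hmem.toLp _
  set u : Lp ℂ 2 μ := indicatorConstLp 2 hB'm hB'top m
  have hu : u =ᵐ[μ] B'.indicator fun _ => m := indicatorConstLp_coeFn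
  have hcalc : ∀ N : ℕ, ‖c‖ ≤ N → ∀ ξ, truncFourier μ χ N ψ ξ = B'.indicator (fun _ => m) ξ := by
    intro N hN ξ
    rw [truncFourier_congr hmem.coeFn_toLp, truncFourier]
    have h1 : ∀ x, (χ (ξ * x) : ℂ) * B.indicator (fun x => (χ (η * x) : ℂ)) x
        = B.indicator (fun x => (χ ((ξ + η) * x) : ℂ)) x := by
      intro x
      by_cases hx : x ∈ B
      · rw [Set.indicator_of_mem hx, Set.indicator_of_mem hx, add_mul, AddChar.map_add_eq_mul,
          Circle.coe_mul]
      · rw [Set.indicator_of_notMem hx, Set.indicator_of_notMem hx, mul_zero]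
    simp only [h1]
    rw [setIntegral_indicator hBm, Set.inter_eq_right.2 (Metric.closedBall_subset_closedBall hN),
      hK.setIntegral_char_mul]
    have h2 : ξ ∈ B' ↔ ‖ξ + η‖ * ‖c‖ ≤ 1 := by
      rw [hB', mem_closedBall_iff_norm, sub_neg_eq_add, ← one_div,
        le_div_iff₀ (norm_pos_iff.2 hc0)]
    by_cases hξ : ξ ∈ B'
    · rw [if_pos (h2.1 hξ), Set.indicator_of_mem hξ]
    · rw [if_neg (mt h2.2 hξ), Set.indicator_of_notMem hξ]
  refine ⟨ψ, u, ?_, ?_, ?_⟩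
  · rw [isFourier_iff]
    refine tendsto_const_nhds.congr' ?_
    obtain ⟨N0, hN0⟩ := exists_nat_ge ‖c‖
    filter_upwards [eventually_ge_atTop N0] with N hN
    have h1 : (fun ξ => truncFourier μ χ N ψ ξ - u ξ) =ᵐ[μ] 0 := by
      filter_upwards [hu] with ξ hξ
      rw [hξ, hcalc N (hN0.trans (by exact_mod_cast hN))]
      simp
    rw [eLpNorm_congr_ae h1, eLpNorm_zero]
  · intro h0
    have h1 : ‖u‖ = ‖m‖ * μ.real B' ^ (1 / (2 : ENNReal).toReal) :=
      norm_indicatorConstLp (by norm_num) (by norm_num)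
    rw [h0, norm_zero] at h1
    have h2 := measureReal_closedBall_pos (μ := μ) (-η) (inv_pos.2 (norm_pos_iff.2 hc0))
    have h3 : 0 < ‖m‖ * μ.real B' ^ (1 / (2 : ENNReal).toReal) :=
      mul_pos (norm_pos_iff.2 hm0) (Real.rpow_pos_of_pos h2 _)
    linarith
  · filter_upwards [hu] with ξ hξ hξ0
    have h1 : ξ ∈ B' := by
      by_contra h2
      rw [hξ, Set.indicator_of_notMem h2] at hξ0
      exact hξ0 rfl
    rw [hB', mem_closedBall_iff_norm, hc, ← zpow_neg] at h1
    have h2 : ‖ξ + η‖ < max ‖ξ‖ ‖η‖ := by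
      rw [← sub_neg_eq_add]
      refine lt_of_le_of_lt h1 (lt_of_lt_of_le ?_ (le_max_right _ _))
      rw [hη]
      exact zpow_lt_zpow_right₀ hq (by omega)
    rw [IsUltrametricDist.norm_eq_of_add_norm_lt_max h2, hη]

end Characters

/-! ### Injectivity of the Fourier transform on L². -/

section Injectivity

open scoped ENNReal

variable {K : Type*} [NontriviallyNormedField K] [IsUltrametricDist K] [MeasurableSpace K]
  {p : ℕ} {μ : Measure K} {χ : AddChar K Circle} [ProperSpace K] [BorelSpace K]

/-- Pairing a truncated Fourier transform with a character on a ball averages the function over a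
ball of the reciprocal radius. -/
lemma IsNormalized.setIntegral_char_mul_truncFourier (hK : IsNormalized p μ χ) (f : Lp ℂ 2 μ)
    (a c : K) (hc : c ≠ 0) {N : ℕ} (hN : max ‖a‖ ‖c‖ ≤ N) :
    ∫ ξ in Metric.closedBall (0 : K) ‖c⁻¹‖, (χ (ξ * (-a)) : ℂ) * truncFourier μ χ N f ξ ∂μ
      = μ.real (Metric.closedBall (0 : K) ‖c⁻¹‖) * ∫ x in Metric.closedBall a ‖c‖, f x ∂μ := by
  have := hK.isAddHaar
  have hχ := hK.continuous_char
  set B' := Metric.closedBall (0 : K) ‖c⁻¹‖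
  set B := Metric.closedBall (0 : K) (N : ℝ) with hB
  have hBm : MeasurableSet B := Metric.isClosed_closedBall.measurableSet
  have hBam : MeasurableSet (Metric.closedBall a ‖c‖) := Metric.isClosed_closedBall.measurableSet
  have : IsFiniteMeasure (μ.restrict B') :=
    ⟨by rw [Measure.restrict_apply_univ]; exact (isCompact_closedBall _ _).measure_lt_top⟩
  have : IsFiniteMeasure (μ.restrict B) :=
    ⟨by rw [Measure.restrict_apply_univ]; exact (isCompact_closedBall _ _).measure_lt_top⟩
  have hf : Integrable f (μ.restrict B) := integrableOn_closedBall f 0 N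
  have hint : Integrable (Function.uncurry fun ξ x => (χ (ξ * (x - a)) : ℂ) * f x)
      ((μ.restrict B').prod (μ.restrict B)) := by
    have h1 : Integrable (fun z : K × K => f z.2) ((μ.restrict B').prod (μ.restrict B)) :=
      hf.comp_snd _
    refine Integrable.bdd_mul (c := 1) h1 ?_ (Eventually.of_forall fun z => (Circle.norm_coe _).le)
    exact (by fun_prop : Continuous fun z : K × K =>
      (χ (z.1 * (z.2 - a)) : ℂ)).aestronglyMeasurable
  have h1 : ∀ ξ, (χ (ξ * (-a)) : ℂ) * truncFourier μ χ N f ξ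
      = ∫ x in B, (χ (ξ * (x - a)) : ℂ) * f x ∂μ := by
    intro ξ
    rw [truncFourier, ← integral_const_mul]
    congr 1
    ext x
    rw [← mul_assoc, ← Circle.coe_mul, ← AddChar.map_add_eq_mul]
    congr 3
    ring
  simp only [h1]
  rw [integral_integral_swap hint]
  have h2 : ∀ x, ∫ ξ in B', (χ (ξ * (x - a)) : ℂ) * f x ∂μ
      = (μ.real B' : ℂ) * (Metric.closedBall a ‖c‖).indicator f x := by
    intro x
    rw [integral_mul_const]
    simp only [mul_comm _ (x - a)]
    rw [hK.setIntegral_char_mul, norm_inv]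
    have h3 : ‖x - a‖ * ‖c‖⁻¹ ≤ 1 ↔ x ∈ Metric.closedBall a ‖c‖ := by
      rw [mem_closedBall_iff_norm, ← div_eq_mul_inv, div_le_one (norm_pos_iff.2 hc)]
    by_cases hx : x ∈ Metric.closedBall a ‖c‖
    · rw [if_pos (h3.2 hx), Set.indicator_of_mem hx, ← norm_inv]
    · rw [if_neg (mt h3.1 hx), Set.indicator_of_notMem hx, zero_mul, mul_zero]
  simp only [h2]
  rw [integral_const_mul, setIntegral_indicator hBam, Set.inter_eq_right.2]
  intro x hx
  rw [mem_closedBall_iff_norm] at hx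
  rw [hB, mem_closedBall_zero_iff]
  have h3 := IsUltrametricDist.norm_add_le_max (x - a) a
  rw [sub_add_cancel] at h3
  exact h3.trans (max_le (hx.trans ((le_max_right _ _).trans hN)) ((le_max_left _ _).trans hN))

/-- The Fourier transform on `L²` is injective. -/
lemma IsNormalized.eq_zero_of_isFourier_zero (hK : IsNormalized p μ χ) {f : Lp ℂ 2 μ}
    (h : IsFourier μ χ f 0) : f = 0 := by
  have := hK.isAddHaar
  have hχ := hK.continuous_char
  rw [Lp.eq_zero_iff_ae_eq_zero]
  refine ae_eq_zero_of_forall_closedBall (integrableOn_closedBall f) fun a c hc => ?_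
  rw [isFourier_iff] at h
  set B' := Metric.closedBall (0 : K) ‖c⁻¹‖
  have hfin : IsFiniteMeasure (μ.restrict B') :=
    ⟨by rw [Measure.restrict_apply_univ]; exact (isCompact_closedBall _ _).measure_lt_top⟩
  have hm := measureReal_closedBall_pos (μ := μ) (0 : K) (norm_pos_iff.2 (inv_ne_zero hc))
  -- The Hölder constant bounding the L¹ norm by the L² norm on a ball of finite measure; L²
  -- convergence to 0 then forces the ball averages of f to vanish.
  set C : ℝ≥0∞ := (μ.restrict B') Set.univ ^ (1 / (1 : ℝ≥0∞).toReal - 1 / (2 : ℝ≥0∞).toReal)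
  have hC : C ≠ ⊤ := by
    refine ENNReal.rpow_ne_top_of_nonneg (by norm_num) (measure_ne_top _ _)
  have hbound : ∀ N : ℕ, max ‖a‖ ‖c‖ ≤ N →
      ‖μ.real B' * ∫ x in Metric.closedBall a ‖c‖, f x ∂μ‖ₑ
        ≤ eLpNorm (fun ξ => truncFourier μ χ N f ξ - (0 : Lp ℂ 2 μ) ξ) 2 μ * C := by
    intro N hN
    rw [← hK.setIntegral_char_mul_truncFourier f a c hc hN]
    have hcont := continuous_truncFourier hχ N f
    calc _ ≤ ∫⁻ ξ in B', ‖(χ (ξ * (-a)) : ℂ) * truncFourier μ χ N f ξ‖ₑ ∂μ :=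
          enorm_integral_le_lintegral_enorm _
      _ = ∫⁻ ξ in B', ‖truncFourier μ χ N f ξ‖ₑ ∂μ := by
          refine lintegral_congr fun ξ => ?_
          rw [enorm_mul, ← ofReal_norm, Circle.norm_coe, ENNReal.ofReal_one, one_mul]
      _ = eLpNorm (truncFourier μ χ N f) 1 (μ.restrict B') := eLpNorm_one_eq_lintegral_enorm.symm
      _ ≤ eLpNorm (truncFourier μ χ N f) 2 (μ.restrict B') * C :=
          eLpNorm_le_eLpNorm_mul_rpow_measure_univ one_le_two hcont.aestronglyMeasurable
      _ ≤ eLpNorm (truncFourier μ χ N f) 2 μ * C := by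
          gcongr
          exact Measure.restrict_le_self
      _ = _ := by
          congr 1
          refine eLpNorm_congr_ae ?_
          filter_upwards [Lp.coeFn_zero ℂ 2 μ] with ξ hξ
          rw [hξ]
          simp
  have hlim := ENNReal.Tendsto.mul_const h (Or.inr hC)
  rw [zero_mul] at hlim
  obtain ⟨N0, hN0⟩ := exists_nat_ge (max ‖a‖ ‖c‖)
  have h0 : ‖μ.real B' * ∫ x in Metric.closedBall a ‖c‖, f x ∂μ‖ₑ ≤ 0 := by
    refine ge_of_tendsto hlim ?_
    filter_upwards [eventually_ge_atTop N0] with N hN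
    exact hbound N (hN0.trans (by exact_mod_cast hN))
  have h1 := enorm_eq_zero.1 (le_antisymm h0 zero_le)
  exact (mul_eq_zero.1 h1).resolve_left (Complex.ofReal_ne_zero.2 hm.ne')

end Injectivity

/-! ### The `p`-adic Laplacian in Fourier space and its spectrum. -/

section Laplacian

lemma coeFn_finset_sum {K : Type*} [MeasurableSpace K] {μ : Measure K} {ι : Type*}
    (s : Finset ι) (f : ι → Lp ℂ 2 μ) :
    ((∑ i ∈ s, f i : Lp ℂ 2 μ) : K → ℂ) =ᵐ[μ] fun x => ∑ i ∈ s, f i x := by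
  classical
  induction s using Finset.induction_on with
  | empty =>
    filter_upwards [Lp.coeFn_zero ℂ 2 μ] with x h
    rw [Finset.sum_empty, h, Finset.sum_empty, Pi.zero_apply]
  | insert i s hi ih =>
    rw [Finset.sum_insert hi]
    filter_upwards [Lp.coeFn_add (f i) (∑ i ∈ s, f i), ih] with x h1 h2
    rw [h1, Pi.add_apply, h2, Finset.sum_insert hi]

lemma exists_of_ne_zero {K : Type*} [MeasurableSpace K] {μ : Measure K} {u : Lp ℂ 2 μ}
    (hu : u ≠ 0) {P : K → Prop} (hP : ∀ᵐ ξ ∂μ, P ξ) :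
    ∃ ξ, u ξ ≠ 0 ∧ P ξ := by
  by_contra! hc
  refine hu (Lp.eq_zero_iff_ae_eq_zero.2 ?_)
  filter_upwards [hP] with ξ h
  by_contra hξ
  exact hc ξ hξ h

variable {K : Type*} [NontriviallyNormedField K] [IsUltrametricDist K] [MeasurableSpace K]
  {p : ℕ} {μ : Measure K} {χ : AddChar K Circle} [ProperSpace K] [BorelSpace K]
  {V : Type*} [Fintype V] {G : SimpleGraph V} {α : Sym2 V → ℕ}

/-- In Fourier space the `p`-adic Laplacian is multiplication by the matrix `L(‖ξ‖)`. -/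
lemma IsLaplacian.fourier_eq (hK : IsNormalized p μ χ) {f h u w : V → Lp ℂ 2 μ}
    (hL : IsLaplacian μ χ G α f h) (hu : ∀ a, IsFourier μ χ (f a) (u a))
    (hw : ∀ a, IsFourier μ χ (h a) (w a)) :
    ∀ᵐ ξ ∂μ, ∀ a, w a ξ = (lapMatrix G α ((‖ξ‖ : ℝ) : ℂ)).mulVec (fun b => u b ξ) a := by
  classical
  have := hK.isAddHaar
  have hχ := hK.continuous_char
  obtain ⟨A, B, hAB, hh⟩ := hL
  have key : ∀ a b, ∃ W : Lp ℂ 2 μ, IsFourier μ χ (if G.Adj a b then A a b - B a b else 0) W ∧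
      ∀ᵐ ξ ∂μ, W ξ = if G.Adj a b then
        ((‖ξ‖ : ℝ) : ℂ) ^ α s(a, b) * (u a ξ - u b ξ) else 0 := by
    intro a b
    by_cases hab : G.Adj a b
    · obtain ⟨⟨u1, w1, h1, h2, h3⟩, ⟨u2, w2, h4, h5, h6⟩⟩ := hAB a b hab
      obtain rfl := h1.unique hχ (hu a)
      obtain rfl := h4.unique hχ (hu b)
      refine ⟨w1 - w2, by rw [if_pos hab]; exact h3.sub hχ h6, ?_⟩
      filter_upwards [h2, h5, Lp.coeFn_sub w1 w2] with ξ e1 e2 e3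
      rw [if_pos hab, e3, Pi.sub_apply, e1, e2]
      push_cast
      ring
    · refine ⟨0, by rw [if_neg hab]; exact IsFourier.zero, ?_⟩
      filter_upwards [Lp.coeFn_zero ℂ 2 μ] with ξ e
      rw [e, if_neg hab, Pi.zero_apply]
  choose W hW1 hW2 using key
  rw [ae_all_iff]
  intro a
  have h1 : w a = ∑ b, W a b := by
    refine (hw a).unique hχ ?_
    rw [hh a]
    convert IsFourier.sum hχ Finset.univ (hW1 a)
  rw [h1]
  filter_upwards [coeFn_finset_sum Finset.univ (W a), ae_all_iff.2 (hW2 a)] with ξ e1 e2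
  rw [e1, lapMatrix_mulVec]
  exact Finset.sum_congr rfl fun b _ => e2 b

/-- The equation for Δ¹ forces ‖ξ‖ = q^(1-r) wherever the transform is nonzero, so ‖ξ‖^n acts there
as the scalar (q^(1-r))^n. -/
lemma IsScale.isVladimirov (hK : IsNormalized p μ χ) {r : ℤ} {ψ : Lp ℂ 2 μ}
    (hψ : IsScale μ χ r ψ) (n : ℕ) (c : ℂ) :
    IsVladimirov μ χ n (c • ψ) ((((residueCard K : ℂ) ^ (1 - r)) ^ n * c) • ψ) := by
  have := hK.isAddHaar
  have hχ := hK.continuous_char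
  obtain ⟨u, w, h1, h2, h3⟩ := hψ
  set l : ℂ := (residueCard K : ℂ) ^ (1 - r)
  have hw : w = l • u := h3.unique hχ (h1.smul l)
  refine ⟨c • u, (l ^ n * c) • u, h1.smul c, ?_, h1.smul _⟩
  filter_upwards [h2, Lp.coeFn_smul c u, Lp.coeFn_smul (l ^ n * c) u, Lp.coeFn_smul l u]
    with ξ e1 e2 e3 e4
  rw [e2, e3]
  rw [hw, e4] at e1
  simp only [Pi.smul_apply, smul_eq_mul, pow_one] at e1 ⊢
  by_cases hu : u ξ = 0
  · simp [hu]
  · rw [mul_right_cancel₀ hu e1]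
    push_cast
    ring

/-- An eigenvector of `L_r`, tensored with a function of scale `r`, is an eigenfunction of the
`p`-adic Laplacian. -/
lemma IsScale.isLaplacian (hK : IsNormalized p μ χ) {r : ℤ} {ψ : Lp ℂ 2 μ}
    (hψ : IsScale μ χ r ψ) {v : V → ℂ} {z : ℂ}
    (hv : (lapMatrix G α ((residueCard K : ℂ) ^ (1 - r))).mulVec v = z • v) :
    IsLaplacian μ χ G α (fun a => v a • ψ) (fun a => z • v a • ψ) := by
  classical
  set l : ℂ := (residueCard K : ℂ) ^ (1 - r)
  refine ⟨fun a b => (l ^ α s(a, b) * v a) • ψ, fun a b => (l ^ α s(a, b) * v b) • ψ,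
    fun a b _ => ⟨hψ.isVladimirov hK _ _, hψ.isVladimirov hK _ _⟩, fun a => ?_⟩
  have h1 := congrFun hv a
  rw [lapMatrix_mulVec, Pi.smul_apply, smul_eq_mul] at h1
  simp only
  rw [smul_smul, ← h1, Finset.sum_smul]
  refine Finset.sum_congr rfl fun b _ => ?_
  by_cases hab : G.Adj a b
  · rw [if_pos hab, if_pos hab, ← sub_smul, mul_sub]
  · rw [if_neg hab, if_neg hab, zero_smul]

/-- There are nonzero functions of each scale. -/
lemma IsNormalized.exists_isScale (hK : IsNormalized p μ χ) (r : ℤ) :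
    ∃ ψ u : Lp ℂ 2 μ, IsScale μ χ r ψ ∧ IsFourier μ χ ψ u ∧ u ≠ 0 ∧
      ∀ᵐ ξ ∂μ, u ξ ≠ 0 → ((‖ξ‖ : ℝ) : ℂ) = (residueCard K : ℂ) ^ (1 - r) := by
  obtain ⟨ψ, u, h1, h2, h3⟩ := hK.exists_isFourier (1 - r)
  have h4 : ∀ᵐ ξ ∂μ, u ξ ≠ 0 → ((‖ξ‖ : ℝ) : ℂ) = (residueCard K : ℂ) ^ (1 - r) := by
    filter_upwards [h3] with ξ h hu
    rw [h hu]
    push_cast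
    rfl
  refine ⟨ψ, u, ⟨u, ((residueCard K : ℂ) ^ (1 - r)) • u, h1, ?_, h1.smul _⟩, h1, h2, h4⟩
  filter_upwards [h4, Lp.coeFn_smul ((residueCard K : ℂ) ^ (1 - r)) u] with ξ e1 e2
  rw [e2, Pi.smul_apply, smul_eq_mul, pow_one]
  by_cases hu : u ξ = 0
  · simp [hu]
  · rw [e1 hu]

/-- The block of the `p`-adic Laplacian at scale `r` is the matrix `L_r`. -/
lemma IsNormalized.blockEigenspace_eq (hK : IsNormalized p μ χ) (r : ℤ) (z : ℂ) :
    blockEigenspace μ χ G α r z = Submodule.span ℂ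
      {v | (lapMatrix G α ((residueCard K : ℂ) ^ (1 - r))).mulVec v = z • v} := by
  rw [blockEigenspace]
  congr 1
  ext v
  refine ⟨fun h => ?_, fun hv ψ hψ => hψ.isLaplacian hK hv⟩
  obtain ⟨ψ, u, hψ, hu, hu0, hs⟩ := hK.exists_isScale r
  have h1 := (h ψ hψ).fourier_eq hK (fun a => hu.smul (v a)) (fun a => (hu.smul (v a)).smul z)
  have h2 : ∀ᵐ ξ ∂μ, ∀ a, (v a • u : Lp ℂ 2 μ) ξ = v a * u ξ :=
    ae_all_iff.2 fun a => Lp.coeFn_smul (v a) u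
  have h3 : ∀ᵐ ξ ∂μ, ∀ a, (z • v a • u : Lp ℂ 2 μ) ξ = z * (v a • u : Lp ℂ 2 μ) ξ :=
    ae_all_iff.2 fun a => Lp.coeFn_smul z (v a • u)
  -- Evaluate at one frequency where u does not vanish and all almost-everywhere identities hold;
  -- cancelling u(ξ) leaves the matrix equation.
  obtain ⟨ξ, hξ, ⟨⟨e1, e2⟩, e3⟩, e4⟩ :=
    exists_of_ne_zero hu0 (((h1.and h2).and h3).and hs)
  have hvec : (fun a => (v a • u : Lp ℂ 2 μ) ξ) = u ξ • v := by
    ext a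
    rw [e2, Pi.smul_apply, smul_eq_mul, mul_comm]
  ext a
  have e5 := e1 a
  rw [hvec, e3, e2, e4 hξ, Matrix.mulVec_smul, Pi.smul_apply, smul_eq_mul] at e5
  rw [Pi.smul_apply, smul_eq_mul]
  refine mul_left_cancel₀ hξ ?_
  rw [← e5]
  ring

/-- The multiset `Spec Λ` is the union of the multisets `Spec L_r`. -/
theorem IsNormalized.specLambda_eq (hK : IsNormalized p μ χ) (z : ℂ) :
    specLambda μ χ G α z = unionCount G α (residueCard K) z := by
  classical
  rw [specLambda, unionCount]
  congr 1
  ext1 r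
  rw [hK.blockEigenspace_eq]
  have hH : (lapMatrix G α ((residueCard K : ℂ) ^ (1 - r))).IsHermitian := by
    have h := lapMatrix_isHermitian (𝕜 := ℂ) G α ((residueCard K : ℝ) ^ (1 - r))
    simpa using h
  have h1 := count_roots_charpoly_eq_finrank hH z
  have h2 : {v | (lapMatrix G α ((residueCard K : ℂ) ^ (1 - r))).mulVec v = z • v}
      = ((LinearMap.ker (lapMatrix G α ((residueCard K : ℂ) ^ (1 - r)) - z • 1).mulVecLin :
        Submodule ℂ (V → ℂ)) : Set (V → ℂ)) := by
    ext v
    simp [sub_eq_zero]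
  rw [h2, Submodule.span_eq, ← h1, specL]

lemma mem_specL_iff {q : ℕ} {r : ℤ} {z : ℂ} : z ∈ specL q G α r ↔
    ∃ v : V → ℂ, v ≠ 0 ∧ (lapMatrix G α ((q : ℂ) ^ (1 - r))).mulVec v = z • v := by
  classical
  have h : z ∈ specL q G α r ↔ ∃ v : V → ℂ, v ≠ 0 ∧
      (Matrix.scalar V z - lapMatrix G α ((q : ℂ) ^ (1 - r))).mulVec v = 0 := by
    rw [Matrix.exists_mulVec_eq_zero_iff, ← Matrix.eval_charpoly, specL,
      mem_roots (Matrix.charpoly_monic _).ne_zero, Polynomial.IsRoot]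
  rw [h]
  refine exists_congr fun v => and_congr_right fun _ => ?_
  have h1 : (Matrix.scalar V z).mulVec v = z • v := by
    ext a
    simp [Matrix.scalar_apply, Matrix.mulVec_diagonal]
  rw [Matrix.sub_mulVec, sub_eq_zero, h1, eq_comm]

lemma zero_mem_specL (hG : G.Connected) (q : ℕ) (r : ℤ) : (0 : ℂ) ∈ specL q G α r := by
  obtain ⟨a⟩ := hG.nonempty
  refine mem_specL_iff.2 ⟨fun _ => 1, fun h => one_ne_zero (congrFun h a), ?_⟩
  ext a
  rw [lapMatrix_mulVec]
  simp

lemma ae_ne_zero [μ.IsAddHaarMeasure] : ∀ᵐ ξ ∂μ, ξ ≠ 0 :=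
  compl_mem_ae_iff.2 (measure_singleton 0)

/-- The eigenvalues of the `p`-adic Laplacian are the eigenvalues of the matrices `L_r`. -/
theorem IsNormalized.isEigenvalue_iff (hK : IsNormalized p μ χ) (hG : G.Connected) (z : ℂ) :
    IsEigenvalue μ χ G α z ↔ ∃ r : ℤ, z ∈ specL (residueCard K) G α r := by
  have := hK.isAddHaar
  constructor
  · rintro ⟨f, hf0, hL⟩
    by_contra! hno
    refine hf0 (funext fun a => ?_)
    -- On one vertex there is no edge, so the domain condition supplies no Fourier transform; but
    -- then Λ = 0 and z = 0. Otherwise every vertex has a neighbour, and the domain condition there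
    -- supplies the transform.
    rcases subsingleton_or_nontrivial V with hV | hV
    · obtain ⟨A, B, -, hh⟩ := hL
      have h1 : z • f a = 0 := by
        refine (hh a).trans (Finset.sum_eq_zero fun b _ => if_neg fun hab => ?_)
        exact hab.ne (Subsingleton.elim a b)
      refine (smul_eq_zero.1 h1).resolve_left fun hz => ?_
      exact hno 0 (hz ▸ zero_mem_specL hG _ _)
    · have hu : ∀ a, ∃ u, IsFourier μ χ (f a) u := by
        intro a
        obtain ⟨A, B, hAB, -⟩ := hL
        obtain ⟨b, hab⟩ := hG.preconnected.exists_adj_of_nontrivial a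
        obtain ⟨⟨u, _, h, -⟩, -⟩ := hAB a b hab
        exact ⟨u, h⟩
      choose u hu using hu
      have h1 := hL.fourier_eq hK hu (fun a => (hu a).smul z)
      have h2 : ∀ᵐ ξ ∂μ, ∀ a, (z • u a : Lp ℂ 2 μ) ξ = z * u a ξ :=
        ae_all_iff.2 fun a => Lp.coeFn_smul z (u a)
      have h3 : u a = 0 := by
        by_contra hua
        obtain ⟨ξ, hξ, ⟨e1, e2⟩, e3⟩ := exists_of_ne_zero hua ((h1.and h2).and ae_ne_zero)
        -- With ‖ξ‖ = q^k the vector of transforms at ξ is an eigenvector of L_r for r = 1 - k.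
        obtain ⟨k, hk⟩ := hK.norm_eq_zpow e3
        refine hno (1 - k) (mem_specL_iff.2 ⟨fun b => u b ξ, fun h => hξ (congrFun h a), ?_⟩)
        ext b
        have e4 := e1 b
        rw [e2, hk] at e4
        rw [Pi.smul_apply, smul_eq_mul, e4, sub_sub_cancel]
        push_cast
        rfl
      have h4 := hu a
      rw [h3] at h4
      exact hK.eq_zero_of_isFourier_zero h4
  · rintro ⟨r, hr⟩
    obtain ⟨v, hv0, hv⟩ := mem_specL_iff.1 hr
    obtain ⟨ψ, u, hψ, hu, hu0, -⟩ := hK.exists_isScale r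
    refine ⟨fun a => v a • ψ, fun h => hv0 (funext fun a => ?_), hψ.isLaplacian hK hv⟩
    refine (smul_eq_zero.1 (congrFun h a)).resolve_right fun hψ0 => hu0 ?_
    rw [hψ0] at hu
    exact hu.eq_zero

end Laplacian

/-! ### A finite list of primes and the resulting strategy. -/

section Game

/-- The strategy that asks for the primes of a list in turn and then stops. -/
def askAll {O : Type*} (ps : List Nat.Primes) (out : History → O) : Strategy O := fun h =>
  if hl : h.length < ps.length then Sum.inl ps[h.length] else Sum.inr (out h)

lemma endsFrom_askAll {O : Type*} (ps : List Nat.Primes) (out : History → O)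
    (ans : Nat.Primes → ℂ → ℕ∞) :
    EndsFrom (askAll ps out) ans [] (ps.map fun p => (p, ans p))
      (out (ps.map fun p => (p, ans p))) := by
  have key : ∀ l₂ l₁ : List Nat.Primes, ps = l₁ ++ l₂ →
      EndsFrom (askAll ps out) ans (l₁.map fun p => (p, ans p)) (ps.map fun p => (p, ans p))
        (out (ps.map fun p => (p, ans p))) := by
    intro l₂
    induction l₂ with
    | nil =>
      rintro l₁ rfl
      rw [List.append_nil]
      exact EndsFrom.finish _ _ (by simp [askAll])
    | cons p l₂ ih =>
      intro l₁ h
      refine EndsFrom.ask _ p _ _ (by simp [askAll, h]) ?_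
      have h1 := ih (l₁ ++ [p]) (by simp [h])
      rwa [List.map_append] at h1
  exact key ps [] rfl

/-- The graphs that are admitted in the game. -/
def Admissible {V : Type*} (α : Sym2 V → ℕ) (G : SimpleGraph V) : Prop :=
  G.Connected ∧ ∀ e ∈ G.edgeSet, 0 < α e

variable {K : Nat.Primes → Type*} [∀ p, NontriviallyNormedField (K p)]
  [∀ p, IsUltrametricDist (K p)] [∀ p, ProperSpace (K p)] [∀ p, MeasurableSpace (K p)]
  [∀ p, BorelSpace (K p)] {μ : ∀ p, Measure (K p)} {χ : ∀ p, AddChar (K p) Circle}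
  {V : Type*} [Fintype V] {α : Sym2 V → ℕ}

lemma exists_prime_specLambda_ne (hK : ∀ p : Nat.Primes, IsNormalized (p : ℕ) (μ p) (χ p))
    {G G' : SimpleGraph V} (hG : Admissible α G) (hG' : Admissible α G')
    (hne : spectralPolynomial G α ≠ spectralPolynomial G' α) :
    ∃ p : Nat.Primes, specLambda (μ p) (χ p) G α ≠ specLambda (μ p) (χ p) G' α := by
  obtain ⟨Q, hQ⟩ := exists_forall_unionCount_ne hG.1 hG.2 hG'.1 hG'.2 hne
  obtain ⟨p, hp⟩ : ∃ p : Nat.Primes, Q ≤ p := by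
    obtain ⟨p, hQp, hp⟩ := Nat.exists_infinite_primes Q
    exact ⟨⟨p, hp⟩, hQp⟩
  refine ⟨p, fun h => hQ _ (hp.trans ((hK p).le_residueCard p.2)) (funext fun z => ?_)⟩
  rw [← (hK p).specLambda_eq, ← (hK p).specLambda_eq, h]

variable (α) in
/-- There is a finite list of primes for which the spectra of the `p`-adic Laplacians determine the
spectral polynomial. -/
lemma exists_separating_primes (hK : ∀ p : Nat.Primes, IsNormalized (p : ℕ) (μ p) (χ p)) :
    ∃ ps : List Nat.Primes, ps ≠ [] ∧ ∀ G G' : SimpleGraph V, Admissible α G → Admissible α G' →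
      (∀ p ∈ ps, specLambda (μ p) (χ p) G α = specLambda (μ p) (χ p) G' α) →
      spectralPolynomial G α = spectralPolynomial G' α := by
  have key : ∀ GG : SimpleGraph V × SimpleGraph V, ∃ p : Nat.Primes,
      Admissible α GG.1 → Admissible α GG.2 →
      specLambda (μ p) (χ p) GG.1 α = specLambda (μ p) (χ p) GG.2 α →
      spectralPolynomial GG.1 α = spectralPolynomial GG.2 α := by
    intro GG
    by_cases h : Admissible α GG.1 ∧ Admissible α GG.2 ∧
      spectralPolynomial GG.1 α ≠ spectralPolynomial GG.2 α
    · obtain ⟨p, hp⟩ := exists_prime_specLambda_ne hK h.1 h.2.1 h.2.2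
      exact ⟨p, fun _ _ h1 => absurd h1 hp⟩
    -- A default for pairs that need no separation. Below, 2 is also put at the head of the list so
    -- that at least one prime is asked.
    · refine ⟨⟨2, Nat.prime_two⟩, fun h1 h2 _ => ?_⟩
      by_contra h3
      exact h ⟨h1, h2, h3⟩
  choose P hP using key
  refine ⟨⟨2, Nat.prime_two⟩ :: (Set.toFinite
    (Set.univ : Set (SimpleGraph V × SimpleGraph V))).toFinset.toList.map P, by simp,
    fun G G' hG hG' h => hP (G, G') hG hG' (h _ ?_)⟩
  exact List.mem_cons_of_mem _ (List.mem_map_of_mem (by simp))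

end Game

end DiffusionPair

end

theorem mainTheorem4
    (K : Nat.Primes → Type*) [∀ p, NontriviallyNormedField (K p)] [∀ p, IsUltrametricDist (K p)]
    [∀ p, LocallyCompactSpace (K p)] [∀ p, MeasurableSpace (K p)] [∀ p, BorelSpace (K p)]
    (μ : ∀ p, Measure (K p)) (χ : ∀ p, AddChar (K p) Circle)
    (hK : ∀ p : Nat.Primes, DiffusionPair.IsNormalized (p : ℕ) (μ p) (χ p))
    {V : Type*} [Fintype V] (α : Sym2 V → ℕ) :
    ∃ (σ : DiffusionPair.Strategy (Nat.Primes → ℤ → Multiset ℂ)) (S : Finset ℤ)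
      (recover : Nat.Primes → (S → Multiset ℂ) →
        ℤ[X][X] × Set (Projectivization (AlgebraicClosure ℚ) (Fin 3 → AlgebraicClosure ℚ))),
      ∀ G : SimpleGraph V, G.Connected → (∀ e ∈ G.edgeSet, 0 < α e) →
        ∃ (h : DiffusionPair.History) (sorted : Nat.Primes → ℤ → Multiset ℂ),
          DiffusionPair.EndsFrom σ
            (fun p => DiffusionPair.specLambda (μ p) (χ p) G α) [] h sorted ∧
          h ≠ [] ∧
          ∀ x ∈ h,
            (∀ r : ℤ, sorted x.1 r
              = DiffusionPair.specL (DiffusionPair.residueCard (K x.1)) G α r) ∧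
            (∀ z : ℂ, DiffusionPair.specLambda (μ x.1) (χ x.1) G α z
              = ∑' r : ℤ, ((sorted x.1 r).count z : ℕ∞)) ∧
            (∀ z : ℂ, DiffusionPair.IsEigenvalue (μ x.1) (χ x.1) G α z
              ↔ ∃ r : ℤ, z ∈ sorted x.1 r) ∧
            recover x.1 (fun r : S => sorted x.1 r)
              = (DiffusionPair.spectralPolynomial G α, DiffusionPair.spectralCurve G α) := by
  classical
  have : ∀ p, ProperSpace (K p) := fun p => ProperSpace.of_locallyCompactSpace (K p)
  obtain ⟨ps, hps0, hps⟩ := DiffusionPair.exists_separating_primes (V := V) α hK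
  -- The output uses any admissible graph that explains the history. It may differ from G, but has
  -- the same spectral polynomial and so the same Spec L_r for every p and r.
  set out : DiffusionPair.History → Nat.Primes → ℤ → Multiset ℂ := fun h =>
    if hG : ∃ G : SimpleGraph V, DiffusionPair.Admissible α G ∧
        ∀ x ∈ h, x.2 = DiffusionPair.specLambda (μ x.1) (χ x.1) G α
    then fun p r => DiffusionPair.specL (DiffusionPair.residueCard (K p)) hG.choose α r
    else fun _ _ => 0
  refine ⟨DiffusionPair.askAll ps out,
    -- One interpolation node more than the degree bound.
    (Finset.range (DiffusionPair.degreeBound α + 1)).map Nat.castEmbedding,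
    -- The rule picks any graph with the given spectra, admissible or not: interpolation shows that
    -- its polynomial is the right one. The default (0, ∅) does not arise in the play.
    fun p fam => if hG : ∃ G : SimpleGraph V, ∀ r,
        fam r = DiffusionPair.specL (DiffusionPair.residueCard (K p)) G α r
      then (DiffusionPair.spectralPolynomial hG.choose α, DiffusionPair.spectralCurve hG.choose α)
      else (0, ∅), fun G hGc hGα => ?_⟩
  set ans : Nat.Primes → ℂ → ℕ∞ := fun p => DiffusionPair.specLambda (μ p) (χ p) G α
  have hex : ∃ G' : SimpleGraph V, DiffusionPair.Admissible α G' ∧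
      ∀ x ∈ ps.map fun p => (p, ans p),
        x.2 = DiffusionPair.specLambda (μ x.1) (χ x.1) G' α := by
    refine ⟨G, ⟨hGc, hGα⟩, fun x hx => ?_⟩
    obtain ⟨p, -, rfl⟩ := List.mem_map.1 hx
    rfl
  have hP : DiffusionPair.spectralPolynomial hex.choose α
      = DiffusionPair.spectralPolynomial G α := by
    refine hps _ _ hex.choose_spec.1 ⟨hGc, hGα⟩ fun p hp => ?_
    exact (hex.choose_spec.2 (p, ans p) (List.mem_map_of_mem hp)).symm
  have hout : ∀ p r, out (ps.map fun p => (p, ans p)) p r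
      = DiffusionPair.specL (DiffusionPair.residueCard (K p)) G α r := by
    intro p r
    simp only [out]
    rw [dif_pos hex]
    exact DiffusionPair.specL_congr hP _ r
  refine ⟨_, _, DiffusionPair.endsFrom_askAll ps out ans, by simpa using hps0, fun x _ => ?_⟩
  refine ⟨hout x.1, fun z => ?_, fun z => ?_, ?_⟩
  · simp only [hout]
    exact (hK x.1).specLambda_eq z
  · simp only [hout]
    exact (hK x.1).isEigenvalue_iff hGc z
  · have hG' : ∃ G' : SimpleGraph V,
        ∀ r : (Finset.range (DiffusionPair.degreeBound α + 1)).map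
            (Nat.castEmbedding : ℕ ↪ ℤ),
          out (ps.map fun p => (p, ans p)) x.1 r
            = DiffusionPair.specL (DiffusionPair.residueCard (K x.1)) G' α r :=
      ⟨G, fun r => hout x.1 r⟩
    have hP' : DiffusionPair.spectralPolynomial hG'.choose α
        = DiffusionPair.spectralPolynomial G α := by
      refine DiffusionPair.spectralPolynomial_eq_of_specL (hK x.1).two_le_residueCard
        (S := (Finset.range (DiffusionPair.degreeBound α + 1)).map Nat.castEmbedding)
        (by simp) fun r hr => ?_
      rw [← hout x.1 r]
      exact (hG'.choose_spec ⟨r, hr⟩).symm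
    refine (dif_pos hG').trans ?_
    rw [DiffusionPair.spectralCurve, DiffusionPair.spectralCurve, hP']
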